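/- Proposition 5.4. For a $k$-linear category $\mathcal T$ with $k$-linear suspension (auto-equivalence) $\Sigma$ and $n\in\mathbb Z$, let $Z^n(\mathcal T)$ be the $k$-module of natural transformations $\eta\colon \mathrm{id}_{\mathcal T}\to\Sigma^n$ with $\eta\Sigma=(-1)^n\Sigma\eta$, and let $Z^*(\mathcal T)=\bigoplus_{n\in\mathbb Z}Z^n(\mathcal T)$ be the graded center, a graded $k$-algebra under composition of natural transformations, $(\eta\zeta)_X=\eta_{\Sigma^mX}\circ\zeta_X$ for $\eta\in Z^n(\mathcal T)$, $\zeta\in Z^m(\mathcal T)$. For a commutative ring $R$ and an $R$-module $M$, let $T(R,M)=R\oplus M$ denote the trivial extension ring, with multiplication $(a,m)(a',m')=(aa',am'+ma')$. Let $k$ be any field, let $\operatorname{mod}(k[x]/(x^2))$ be the category of finitely generated $k[x]/(x^2)$-modules, and let $D^b(\operatorname{mod}(k[x]/(x^2)))$ be its bounded derived category. Then there is an isomorphism of $\mathbb Z$-graded $k$-algebras $$Z^*\bigl(D^b(\operatorname{mod}(k[x]/(x^2)))\bigr)\;\cong\; T\Bigl(k[\zeta],\prod_{r\ge 0}k\Bigr),$$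 where $k[\zeta]$ is the polynomial ring in one variable $\zeta$, each factor $k=k[\zeta]/(\zeta)$ is regarded as a $k[\zeta]$-module on which $\zeta$ acts by zero, the ideal $\prod_{r\ge0}k$ is concentrated in degree $0$, and $\zeta$ has degree $2$ if $\operatorname{char}k\ne2$ and degree $1$ if $\operatorname{char}k=2$. Moreover, for the degree-$0$ part there is an isomorphism of $k$-algebras $$Z^0\bigl(D^b(\operatorname{mod}(k[x]/(x^2)))\bigr)\;\cong\; T\Bigl(k,\prod_{r\ge0}k\Bigr).$$ -/

import Mathlib

open CategoryTheory Polynomial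

universe w u

section GradedCenter

variable (k : Type*) [Field k] (C : Type*) [Category* C] [HasShift C ℤ] [Preadditive C]
  [Linear k C] [∀ n : ℤ, (shiftFunctor C n).Additive] [∀ n : ℤ, (shiftFunctor C n).Linear k]

/-- The degree `n` part of the graded center of a `k`-linear category `C` with suspension
`Σ = ⟦1⟧`: the natural transformations `η : id ⟶ Σⁿ` such that `ηΣ = (-1)ⁿ Ση`, where
`Σ(ΣⁿX) = X⟦n⟧⟦1⟧` and `Σⁿ(ΣX) = X⟦1⟧⟦n⟧` are identified by the canonical isomorphism
`shiftComm` (which contains no sign). -/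
def gradedCenter (n : ℤ) : Submodule k (𝟭 C ⟶ shiftFunctor C n) where
  carrier := {η | ∀ X : C, η.app (X⟦(1 : ℤ)⟧) =
    n.negOnePow • ((η.app X)⟦(1 : ℤ)⟧' ≫ (shiftComm X n 1).hom)}
  add_mem' {η ζ} hη hζ X := by
    have h1 := hη X
    have h2 := hζ X
    simp only [NatTrans.app_add, Functor.map_add, Preadditive.add_comp, smul_add, h1, h2]
  zero_mem' X := by
    simp
  smul_mem' c η hη X := by
    have h1 := hη X
    simp only [NatTrans.app_smul, Functor.map_smul, Linear.smul_comp, h1]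
    exact smul_comm _ _ _

end GradedCenter

namespace gradedCenter

section Shift

variable {C : Type*} [Category* C] [HasShift C ℤ]

/-- The suspension of a shifted morphism. -/
noncomputable def susp {X Y : C} {a : ℤ} (f : ShiftedHom X Y a) :
    ShiftedHom (X⟦(1 : ℤ)⟧) (Y⟦(1 : ℤ)⟧) a :=
  f⟦(1 : ℤ)⟧' ≫ (shiftComm Y a 1).hom

lemma susp_comp {X Y Z : C} {a b c : ℤ} (f : ShiftedHom X Y a) (g : ShiftedHom Y Z b)
    (h : b + a = c) : susp (f.comp g h) = (susp f).comp (susp g) h := by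
  subst h
  have H := shiftFunctorComm_hom_app_comp_shift_shiftFunctorAdd_hom_app (C := C) 1 b a Z
  have e : ∀ (W : C) (n : ℤ), (shiftComm W n 1).hom = (shiftFunctorComm C 1 n).inv.app W :=
    fun W n => by rw [← shiftComm_symm W 1 n]; rfl
  have H' : ((shiftFunctorAdd C b a).inv.app Z)⟦(1 : ℤ)⟧' ≫ (shiftComm Z (b + a) 1).hom =
      (shiftComm (Z⟦b⟧) a 1).hom ≫ (shiftComm Z b 1).hom⟦a⟧' ≫
        (shiftFunctorAdd C b a).inv.app (Z⟦(1 : ℤ)⟧) := by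
    simp only [e]
    rw [← cancel_epi (((shiftFunctorAdd C b a).hom.app Z)⟦(1 : ℤ)⟧'),
      ← cancel_epi ((shiftFunctorComm C 1 (b + a)).hom.app Z)]
    trans 𝟙 _
    · rw [← Functor.map_comp_assoc, Iso.hom_inv_id_app]
      simp
    · rw [reassoc_of% H, Iso.hom_inv_id_app_assoc, ← Functor.map_comp_assoc, Iso.hom_inv_id_app]
      simp
  have N := shiftComm_hom_comp g 1 a
  have N' : (g⟦a⟧')⟦(1 : ℤ)⟧' ≫ (shiftComm (Z⟦b⟧) a 1).hom =
      (shiftComm Y a 1).hom ≫ (g⟦(1 : ℤ)⟧')⟦a⟧' := (shiftComm_hom_comp g a 1).symm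
  simp only [susp, ShiftedHom.comp, shiftFunctorAdd'_eq_shiftFunctorAdd, Functor.map_comp,
    Category.assoc, H']
  rw [reassoc_of% N']

/-- The composition `ηζ : id ⟶ Σᵇ ⟶ Σᵃ Σᵇ = Σᵃ⁺ᵇ` of two natural transformations, with
components `(ηζ)_X = η_{ΣᵇX} ∘ ζ_X`. -/
noncomputable def compNat {a b c : ℤ} (η : 𝟭 C ⟶ shiftFunctor C a) (ζ : 𝟭 C ⟶ shiftFunctor C b)
    (h : a + b = c) : 𝟭 C ⟶ shiftFunctor C c :=
  ζ ≫ Functor.whiskerLeft (shiftFunctor C b) η ≫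
    (shiftFunctorAdd' C b a c (by rw [add_comm, h])).inv

lemma compNat_app {a b c : ℤ} (η : 𝟭 C ⟶ shiftFunctor C a) (ζ : 𝟭 C ⟶ shiftFunctor C b)
    (h : a + b = c) (X : C) :
    (compNat η ζ h).app X =
      ShiftedHom.comp (X := X) (Y := X) (Z := X) (η.app X) (ζ.app X) (by rw [add_comm, h]) := by
  have := η.naturality (ζ.app X)
  dsimp [compNat, ShiftedHom.comp] at this ⊢
  rw [← Category.assoc, this, Category.assoc]

end Shift

variable {k : Type*} [Field k] {C : Type*} [Category* C] [HasShift C ℤ] [Preadditive C]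
  [Linear k C] [∀ n : ℤ, (shiftFunctor C n).Additive] [∀ n : ℤ, (shiftFunctor C n).Linear k]

lemma mem_iff {n : ℤ} (η : 𝟭 C ⟶ shiftFunctor C n) :
    η ∈ gradedCenter k C n ↔ ∀ X : C, η.app (X⟦(1 : ℤ)⟧) =
      n.negOnePow • susp (X := X) (Y := X) (η.app X) := Iff.rfl

lemma compNat_mem {a b c : ℤ} {η : 𝟭 C ⟶ shiftFunctor C a} {ζ : 𝟭 C ⟶ shiftFunctor C b}
    (hη : η ∈ gradedCenter k C a) (hζ : ζ ∈ gradedCenter k C b) (h : a + b = c) :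
    compNat η ζ h ∈ gradedCenter k C c := by
  rw [mem_iff] at hη hζ ⊢
  intro X
  subst h
  rw [compNat_app, compNat_app, susp_comp, hη, hζ, Int.negOnePow_add, mul_smul]
  simp only [Units.smul_def, ShiftedHom.comp, Functor.map_zsmul, Preadditive.zsmul_comp,
    Preadditive.comp_zsmul]
  exact smul_comm _ _ _

lemma one_mem : (shiftFunctorZero C ℤ).inv ∈ gradedCenter k C 0 := by
  intro X
  simp only [Int.negOnePow_zero, one_smul]
  rw [shiftFunctorZero_inv_app_shift, ← shiftComm_symm X 1 0]
  rfl

/-- Multiplication of homogeneous elements of the graded center. -/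
noncomputable def mul {a b c : ℤ} (η : gradedCenter k C a) (ζ : gradedCenter k C b)
    (h : a + b = c) : gradedCenter k C c :=
  ⟨compNat η.1 ζ.1 h, compNat_mem η.2 ζ.2 h⟩

lemma hext {n : ℤ} {η ζ : gradedCenter k C n} (h : ∀ X : C, η.1.app X = ζ.1.app X) : η = ζ :=
  Subtype.ext (NatTrans.ext (funext h))

lemma mk_mul {a b c : ℤ} (η : gradedCenter k C a) (ζ : gradedCenter k C b) (h : a + b = c) :
    (⟨a + b, mul η ζ rfl⟩ : GradedMonoid fun n => gradedCenter k C n) = ⟨c, mul η ζ h⟩ := by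
  subst h; rfl

lemma mul_app {a b c : ℤ} (η : gradedCenter k C a) (ζ : gradedCenter k C b) (h : a + b = c)
    (X : C) : (mul η ζ h).1.app X =
      ShiftedHom.comp (X := X) (Y := X) (Z := X) (η.1.app X) (ζ.1.app X) (by rw [add_comm, h]) :=
  compNat_app _ _ h X

variable (k C) in
/-- The unit of the graded center: the canonical isomorphism `id ≅ Σ⁰`. -/
noncomputable def one : gradedCenter k C 0 := ⟨(shiftFunctorZero C ℤ).inv, one_mem⟩

noncomputable instance gOne : GradedMonoid.GOne (fun n : ℤ => gradedCenter k C n) where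
  one := one k C

noncomputable instance gMul : GradedMonoid.GMul (fun n : ℤ => gradedCenter k C n) where
  mul η ζ := mul η ζ rfl

lemma one_app (X : C) : (one k C).1.app X =
    ShiftedHom.mk₀ (0 : ℤ) rfl (𝟙 X) := by
  simp [ShiftedHom.mk₀, shiftFunctorZero', one]

/-- The graded ring structure given by the composition of natural transformations. -/
noncomputable instance gRing : DirectSum.GRing (fun n : ℤ => gradedCenter k C n) where
  mul_zero η := hext fun X => by
    change (mul η 0 rfl).1.app X = 0
    rw [mul_app]
    simp [ShiftedHom.comp]
  zero_mul η := hext fun X => by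
    change (mul 0 η rfl).1.app X = 0
    rw [mul_app]
    simp [ShiftedHom.comp]
  mul_add η ζ ξ := hext fun X => by
    change (mul η (ζ + ξ) rfl).1.app X = (mul η ζ rfl).1.app X + (mul η ξ rfl).1.app X
    simp only [mul_app]
    exact ShiftedHom.comp_add _ _ _ _
  add_mul η ζ ξ := hext fun X => by
    change (mul (η + ζ) ξ rfl).1.app X = (mul η ξ rfl).1.app X + (mul ζ ξ rfl).1.app X
    simp only [mul_app]
    exact ShiftedHom.add_comp _ _ _ _
  one_mul := by
    rintro ⟨a, η⟩
    refine (mk_mul _ _ (zero_add a)).trans (congrArg (GradedMonoid.mk a) (hext fun X => ?_))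
    rw [mul_app]
    change ShiftedHom.comp (X := X) (Y := X) (Z := X) ((one k C).1.app X) (η.1.app X) _ = _
    rw [one_app]
    exact ShiftedHom.mk₀_id_comp _ _ _
  mul_one := by
    rintro ⟨a, η⟩
    refine (mk_mul _ _ (add_zero a)).trans (congrArg (GradedMonoid.mk a) (hext fun X => ?_))
    rw [mul_app]
    change ShiftedHom.comp (X := X) (Y := X) (Z := X) (η.1.app X) ((one k C).1.app X) _ = _
    rw [one_app]
    exact ShiftedHom.comp_mk₀_id _ _ _
  mul_assoc := by
    rintro ⟨a, η⟩ ⟨b, ζ⟩ ⟨c, ξ⟩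
    refine (mk_mul (mul η ζ rfl) ξ (add_assoc a b c)).trans
      (congrArg (GradedMonoid.mk (a + (b + c))) (hext fun X => ?_))
    change (mul (mul η ζ rfl) ξ _).1.app X = (mul η (mul ζ ξ rfl) rfl).1.app X
    simp only [mul_app]
    exact ShiftedHom.comp_assoc _ _ _ _ _ (by ring)
  natCast n := n • one k C
  natCast_zero := zero_smul ℕ (one k C)
  natCast_succ n := succ_nsmul (one k C) n
  intCast n := n • one k C
  intCast_ofNat n := natCast_zsmul (one k C) n
  intCast_negSucc_ofNat n := negSucc_zsmul (one k C) n

lemma smul_one_mul {a : ℤ} (r : k) (η : gradedCenter k C a) :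
    mul (r • (one k C)) η (zero_add a) = r • η :=
  hext fun X => by
    change (mul _ η _).1.app X = r • η.1.app X
    rw [mul_app]
    change ShiftedHom.comp (X := X) (Y := X) (Z := X)
      (r • (one k C).1.app X) (η.1.app X) _ = _
    rw [ShiftedHom.smul_comp, one_app, ShiftedHom.mk₀_id_comp]

lemma mul_smul_one {a : ℤ} (r : k) (η : gradedCenter k C a) :
    mul η (r • (one k C)) (add_zero a) = r • η :=
  hext fun X => by
    change (mul η _ _).1.app X = r • η.1.app X
    rw [mul_app]
    change ShiftedHom.comp (X := X) (Y := X) (Z := X) (η.1.app X)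
      (r • (one k C).1.app X) _ = _
    rw [ShiftedHom.comp_smul, one_app, ShiftedHom.comp_mk₀_id]

/-- The graded center is a graded `k`-algebra. -/
noncomputable instance gAlgebra : DirectSum.GAlgebra k (fun n : ℤ => gradedCenter k C n) where
  toFun := (LinearMap.toSpanSingleton k (gradedCenter k C 0) (one k C)).toAddMonoidHom
  map_one := one_smul k _
  map_mul r s := by
    refine Eq.trans ?_ (mk_mul _ _ (zero_add 0)).symm
    refine congrArg (GradedMonoid.mk 0) ?_
    exact (mul_smul r s _).trans (smul_one_mul r (s • one k C)).symm
  commutes r := by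
    rintro ⟨a, η⟩
    refine (mk_mul _ _ (zero_add a)).trans (Eq.trans ?_ (mk_mul _ _ (add_zero a)).symm)
    exact congrArg (GradedMonoid.mk a) ((smul_one_mul r η).trans (mul_smul_one r η).symm)
  smul_def r := by
    rintro ⟨a, η⟩
    refine Eq.trans ?_ (mk_mul _ _ (zero_add a)).symm
    exact congrArg (GradedMonoid.mk a) (smul_one_mul r η).symm

end gradedCenter

section Total

variable (k : Type*) [Field k] (C : Type*) [Category* C] [HasShift C ℤ] [Preadditive C]
  [Linear k C] [∀ n : ℤ, (shiftFunctor C n).Additive] [∀ n : ℤ, (shiftFunctor C n).Linear k]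

open DirectSum in
/-- The graded center `Z*(C) = ⨁ₙ Zⁿ(C)` of `C`. -/
abbrev GradedCenter := ⨁ n : ℤ, gradedCenter k C n

/-- The homogeneous elements of degree `n` in `Z*(C)`. -/
noncomputable def GradedCenter.homogeneous (n : ℤ) : Submodule k (GradedCenter k C) :=
  LinearMap.range (DirectSum.lof k ℤ (fun n : ℤ => gradedCenter k C n) n)

/-- The degree `0` part `Z⁰(C)` of `Z*(C)`, as an algebra. -/
noncomputable def GradedCenter.degreeZero : Subalgebra k (GradedCenter k C) where
  carrier := GradedCenter.homogeneous k C 0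
  mul_mem' := by
    rintro _ _ ⟨a, rfl⟩ ⟨b, rfl⟩
    refine ⟨gradedCenter.mul a b (zero_add 0), ?_⟩
    refine Eq.trans ?_ (DirectSum.of_mul_of _ _).symm
    exact (DirectSum.of_eq_of_gradedMonoid_eq (gradedCenter.mk_mul a b (zero_add 0))).symm
  add_mem' := Submodule.add_mem _
  algebraMap_mem' r := ⟨_, rfl⟩

end Total

instance CategoryTheory.ObjectProperty.shiftFunctor_linear (k : Type*) [Ring k] {C : Type*}
    [Category* C] (P : ObjectProperty C) [HasShift C ℤ] [P.IsStableUnderShift ℤ] [Preadditive C]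
    [Linear k C] (n : ℤ) [(shiftFunctor C n).Linear k] :
    (shiftFunctor P.FullSubcategory n).Linear k where
  map_smul {X Y} f r := by
    have := Functor.linear_of_iso k (P.ι.commShiftIso n).symm
    apply P.ι.map_injective
    have h := (shiftFunctor P.FullSubcategory n ⋙ P.ι).map_smul r f
    rw [P.ι.map_smul]
    exact h

section DualNumbers

variable (k : Type u) [Field k]

/-- The algebra of dual numbers `k[x]/(x²)`. -/
abbrev DualNumbers : Type u := k[X] ⧸ Ideal.span {(X : k[X]) ^ 2}

/-- `D^b(mod k[x]/(x²))`, the bounded derived category of the abelian category of finitely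
generated modules. -/
abbrev BoundedDerivedDual [HasDerivedCategory.{w} (FGModuleCat.{u} (DualNumbers k))] : Type (u + 1) :=
  DerivedCategory.Bounded (FGModuleCat.{u} (DualNumbers k))

/-- The trivial extension algebra `T(k[ζ], ∏_{r ≥ 0} k)`, where `k = k[ζ]/(ζ)` as a
`k[ζ]`-module. -/
abbrev TrivExt : Type u := TrivSqZeroExt k[X] (ℕ → k[X] ⧸ Ideal.span {(X : k[X])})

/-- The homogeneous elements of degree `n` of `T(k[ζ], ∏_{r ≥ 0} k)`, where `ζ` has degree `d`
and `∏_{r ≥ 0} k` is concentrated in degree `0`. -/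
def TrivExt.homogeneous (d : ℕ) (n : ℤ) : Submodule k (TrivExt k) where
  carrier := {t | (∀ i : ℕ, (d * i : ℤ) ≠ n → t.fst.coeff i = 0) ∧ (n ≠ 0 → t.snd = 0)}
  add_mem' {s t} hs ht := by
    refine ⟨fun i hi => ?_, fun hn => ?_⟩
    · simp [hs.1 i hi, ht.1 i hi]
    · simp [hs.2 hn, ht.2 hn]
  zero_mem' := by simp
  smul_mem' c t ht := by
    refine ⟨fun i hi => ?_, fun hn => ?_⟩
    · simp [ht.1 i hi]
    · simp [ht.2 hn]

end DualNumbers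

/-! Let `G` be the simple module in degree 0 and Λ = k[x]/(x²). Since Λ is projective, the triangle
G → Λ → G → G[1] shows that the graded endomorphism ring of `G` is k[z] with z of degree 1
(`PolynomialGenerator.ofDistTriang`). Shifts and extensions of `G` exhaust the category. The rest
uses only these two facts.

The graded k[z]-module Hom*(G, X) is finitely generated, and its decomposition into cyclic modules
lifts to X: the identity of X is a finite sum of morphisms through shifts of `G` and of the cones
K_r of z^(r+1) (`factorsThrough_objs`). Torsion summands split off by a duality: for a cone A,
Hom(A, X) and Hom(X, A) are in perfect pairing (`Cone.isPerfect`), so a morphism out of A that does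
not kill the socle has a retraction (`Cone.exists_retraction`).

A central element is therefore the same as a family of endomorphisms of `G` and of the K_r which
commutes, up to the Koszul sign, with all shifted morphisms among these objects (`exists_of_family`,
`ext_of_family`). At `G` the component is c z^n, and commuting with z gives 2c = 0 for n odd. If it
vanishes, the component at K_r is a multiple of a composite K_r → G → G → K_r. For n ≠ 0 this is
zero (`component_cone_eq_zero`); for n = 0 it is a multiple of the socle endomorphism, with
coefficients chosen freely for each r (`commutes_family_socle`), whence the square-zero ideal ∏ k.
Conversely z^d extends to all cones when (-1)^d acts trivially (`exists_family_z`), so ζ restricts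
to z in characteristic 2 and to z² otherwise. Positive degree kills the socle elements. -/

set_option linter.unusedSectionVars false

/-! ### Graded morphisms, isomorphisms of nonzero degree and exactness -/

namespace CategoryTheory.ShiftedHom

open Pretriangulated

section Shift

variable {C : Type*} [Category* C] [HasShift C ℤ]

lemma assoc_r {X Y Z T : C} {a b c ab abc : ℤ} (bc : ℤ) {α : ShiftedHom X Y a}
    {β : ShiftedHom Y Z b} {γ : ShiftedHom Z T c} {h₁ : b + a = ab} {h₂ : c + ab = abc}
    (h₃ : c + b = bc) :
    (α.comp β h₁).comp γ h₂ = α.comp (β.comp γ h₃) (by lia) :=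
  comp_assoc _ _ _ _ _ (by lia)

lemma assoc_l {X Y Z T : C} {a b c bc abc : ℤ} (ab : ℤ) {α : ShiftedHom X Y a}
    {β : ShiftedHom Y Z b} {γ : ShiftedHom Z T c} {h₃ : c + b = bc} {h₄ : bc + a = abc}
    (h₁ : b + a = ab) :
    α.comp (β.comp γ h₃) h₄ = (α.comp β h₁).comp γ (by lia) :=
  (comp_assoc _ _ _ _ _ (by lia)).symm

/-- The identity, as a morphism of degree zero. -/
noncomputable abbrev gid (X : C) : ShiftedHom X X (0 : ℤ) := mk₀ 0 rfl (𝟙 X)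

lemma gid_comp {X Y : C} {a : ℤ} (f : ShiftedHom X Y a) (h : a + 0 = a) :
    (gid X).comp f h = f :=
  mk₀_id_comp _ _ _

lemma comp_gid {X Y : C} {a : ℤ} (f : ShiftedHom X Y a) (h : 0 + a = a) :
    f.comp (gid Y) h = f :=
  comp_mk₀_id _ _ _

/-- An isomorphism of degree `n`. -/
structure GIso (X Y : C) (n m : ℤ) where
  hom : ShiftedHom X Y n
  inv : ShiftedHom Y X m
  sum : m + n = 0
  hom_inv : hom.comp inv sum = gid X
  inv_hom : inv.comp hom ((add_comm _ _).trans sum) = gid Y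

namespace GIso

variable {X Y Z : C} {n m : ℤ} (i : GIso X Y n m)

lemma hom_inv_comp {a b : ℤ} (f : ShiftedHom X Z a) (h : a + m = b) (h' : b + n = a) :
    i.hom.comp (i.inv.comp f h) h' = f := by
  rw [assoc_l 0 i.sum, i.hom_inv, gid_comp]

lemma inv_hom_comp {a b : ℤ} (f : ShiftedHom Y Z a) (h : a + n = b) (h' : b + m = a) :
    i.inv.comp (i.hom.comp f h) h' = f := by
  rw [assoc_l 0 (by have := i.sum; lia), i.inv_hom, gid_comp]

lemma comp_hom_inv {a b : ℤ} (f : ShiftedHom Z X a) (h : n + a = b) (h' : m + b = a) :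
    (f.comp i.hom h).comp i.inv h' = f := by
  rw [assoc_r 0 i.sum, i.hom_inv, comp_gid]

lemma comp_inv_hom {a b : ℤ} (f : ShiftedHom Z Y a) (h : m + a = b) (h' : n + b = a) :
    (f.comp i.inv h).comp i.hom h' = f := by
  rw [assoc_r 0 (by have := i.sum; lia), i.inv_hom, comp_gid]

/-- The inverse isomorphism. -/
def symm : GIso Y X m n := ⟨i.inv, i.hom, by have := i.sum; lia, i.inv_hom, i.hom_inv⟩

end GIso

/-- The tautological isomorphism of degree `n` from `X⟦n⟧` to `X`. -/
noncomputable def shiftGIso (X : C) (n : ℤ) : GIso (X⟦n⟧) X n (-n) where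
  hom := 𝟙 (X⟦n⟧)
  inv := (shiftFunctorCompIsoId C n (-n) (by lia)).inv.app X
  sum := by lia
  hom_inv := by
    dsimp only [comp]
    rw [shift_shiftFunctorCompIsoId_inv_app]
    simp [shiftFunctorCompIsoId, mk₀, shiftFunctorZero']
  inv_hom := by
    simp [comp, shiftFunctorCompIsoId, mk₀, shiftFunctorZero']

/-- A shifted morphism as the composition of a morphism and a tautological isomorphism. -/
lemma mk₀_comp_shiftGIso {X Y : C} {n : ℤ} (f : ShiftedHom X Y n) (h : n + 0 = n) :
    (mk₀ (Y := Y⟦n⟧) (0 : ℤ) rfl f).comp (shiftGIso Y n).hom h = f := by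
  rw [mk₀_comp]; exact Category.comp_id _

lemma shiftGIso_naturality {X Y : C} (f : X ⟶ Y) (n : ℤ) (h : n + 0 = n) (h' : 0 + n = n) :
    (mk₀ (0 : ℤ) rfl (f⟦n⟧')).comp (shiftGIso Y n).hom h =
      (shiftGIso X n).hom.comp (mk₀ (0 : ℤ) rfl f) h' := by
  rw [mk₀_comp, comp_mk₀]
  exact (Category.comp_id _).trans (Category.id_comp _).symm

end Shift

variable {C : Type*} [Category* C] [HasShift C ℤ] [Preadditive C]

/-- Exactness of `X ⟶ Y ⟶ Z` after applying the functors of shifted morphisms from and to any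
object. -/
structure IsExactAt {X Y Z : C} {a b : ℤ} (f : ShiftedHom X Y a) (g : ShiftedHom Y Z b) :
    Prop where
  zero : ∀ {c : ℤ} (h : b + a = c), f.comp g h = 0
  lift : ∀ {W : C} {m n c : ℤ} (u : ShiftedHom W Y m) (h : a + n = m) (h' : b + m = c),
    u.comp g h' = 0 → ∃ v : ShiftedHom W X n, u = v.comp f h
  desc : ∀ {W : C} {m n c : ℤ} (u : ShiftedHom Y W m) (h : n + b = m) (h' : m + a = c),
    f.comp u h' = 0 → ∃ v : ShiftedHom Z W n, u = g.comp v h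

variable [∀ n : ℤ, (shiftFunctor C n).Additive]

namespace IsExactAt

variable {X Y Z : C} {a b p q : ℤ} {f : ShiftedHom X Y a} {g : ShiftedHom Y Z b}

lemma comp_iso (H : IsExactAt f g) {Z' : C} (i : GIso Z Z' p q) {c : ℤ} (hc : p + b = c) :
    IsExactAt f (g.comp i.hom hc) where
  zero {d} h := by
    rw [assoc_l (b + a) rfl, H.zero, zero_comp]
  lift {W m n d} u h h' hu := by
    have h0 := i.sum
    have := congrArg (fun x => x.comp i.inv (c := b + m) (by lia)) hu
    simp only [zero_comp] at this
    rw [assoc_l (b + m) rfl, i.comp_hom_inv] at this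
    exact H.lift u h rfl this
  desc {W m n d} u h h' hu := by
    have h0 := i.sum
    obtain ⟨v, rfl⟩ := H.desc u (n := n + p) (by lia) h' hu
    refine ⟨i.inv.comp v (by lia), ?_⟩
    rw [assoc_r (n + p), i.hom_inv_comp]
    lia

lemma iso_comp (H : IsExactAt f g) {X' : C} (i : GIso X' X p q) {c : ℤ} (hc : a + p = c) :
    IsExactAt (i.hom.comp f hc) g where
  zero {d} h := by
    rw [assoc_r (b + a) rfl, H.zero, comp_zero]
  lift {W m n d} u h h' hu := by
    have h0 := i.sum
    obtain ⟨v, rfl⟩ := H.lift u (n := n + p) (by lia) h' hu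
    refine ⟨v.comp i.inv (by lia), ?_⟩
    rw [assoc_l (n + p), i.comp_inv_hom]
    lia
  desc {W m n d} u h h' hu := by
    have h0 := i.sum
    have := congrArg (fun x => i.inv.comp x (c := m + a) (by lia)) hu
    simp only [comp_zero] at this
    rw [assoc_r (m + a) rfl, i.inv_hom_comp] at this
    exact H.desc u h rfl this

lemma conj_iso (H : IsExactAt f g) {Y' : C} (i : GIso Y Y' p q) {c d : ℤ} (hc : p + a = c)
    (hd : b + q = d) : IsExactAt (f.comp i.hom hc) (i.inv.comp g hd) where
  zero {e} h := by
    have := i.sum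
    rw [assoc_r b, i.hom_inv_comp, H.zero]
    lia
  lift {W m n e} u h h' hu := by
    have h0 := i.sum
    rw [assoc_l (q + m) rfl] at hu
    obtain ⟨v, hv⟩ := H.lift (u.comp i.inv rfl) (n := n) (by lia) _ hu
    refine ⟨v, ?_⟩
    rw [assoc_l (q + m) (by lia), ← hv, i.comp_inv_hom]
  desc {W m n e} u h h' hu := by
    have h0 := i.sum
    rw [assoc_r (m + p) rfl] at hu
    obtain ⟨v, hv⟩ := H.desc (i.hom.comp u rfl) (n := n) (by lia) _ hu
    refine ⟨v, ?_⟩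
    rw [assoc_r (m + p) (by lia), ← hv, i.inv_hom_comp]

lemma neg_right (H : IsExactAt f g) : IsExactAt f (-g) where
  zero h := by rw [comp_neg, H.zero, neg_zero]
  lift u h h' hu := H.lift u h h' (by rwa [comp_neg, neg_eq_zero] at hu)
  desc u h h' hu := by
    obtain ⟨v, rfl⟩ := H.desc u h h' hu
    exact ⟨-v, by simp⟩

end IsExactAt

variable [Limits.HasZeroObject C] [Pretriangulated C] {X Y Z : C}

lemma isExactAt_of_distTriang {f : X ⟶ Y} {g : Y ⟶ Z} {h : Z ⟶ X⟦(1 : ℤ)⟧}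
    (hT : Triangle.mk f g h ∈ distTriang C) :
    IsExactAt (mk₀ (0 : ℤ) rfl f) (mk₀ (0 : ℤ) rfl g) where
  zero {c} h := by
    obtain rfl : c = 0 := by lia
    have : f ≫ g = 0 := comp_distTriang_mor_zero₁₂ _ hT
    rw [mk₀_comp_mk₀, this, mk₀_zero]
  lift {W m n c} u h h' hu := by
    obtain rfl : m = n := by lia
    obtain rfl : m = c := by lia
    rw [comp_mk₀] at hu
    -- The morphisms of the triangle shifted by `m` carry the sign (-1)^m; being a unit, it is moved
    -- onto the lift.
    have hu' : u ≫ (m.negOnePow • g⟦m⟧') = 0 := by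
      rw [Units.smul_def, Preadditive.comp_zsmul, hu, smul_zero]
    obtain ⟨(v : W ⟶ X⟦m⟧), (hv : u = v ≫ (m.negOnePow • f⟦m⟧'))⟩ :=
      Triangle.coyoneda_exact₂ _ (Triangle.shift_distinguished _ hT m) u hu'
    refine ⟨m.negOnePow • v, ?_⟩
    rw [comp_mk₀, hv, Units.smul_def, Preadditive.comp_zsmul, Units.smul_def,
      Preadditive.zsmul_comp]
  desc {W m n c} u h h' hu := by
    obtain rfl : n = m := by lia
    obtain rfl : n = c := by lia
    rw [mk₀_comp] at hu
    obtain ⟨(v : Z ⟶ W⟦n⟧), (hv : u = g ≫ v)⟩ := Triangle.yoneda_exact₂ _ hT u hu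
    exact ⟨v, by rw [mk₀_comp, hv]⟩

lemma isExactAt_of_distTriang₂ {f : X ⟶ Y} {g : Y ⟶ Z} {h : Z ⟶ X⟦(1 : ℤ)⟧}
    (hT : Triangle.mk f g h ∈ distTriang C) :
    IsExactAt (mk₀ (0 : ℤ) rfl g) (h : ShiftedHom Z X (1 : ℤ)) := by
  have hT' : Triangle.mk g h (-f⟦(1 : ℤ)⟧') ∈ distTriang C := rot_of_distTriang _ hT
  have := (isExactAt_of_distTriang hT').comp_iso (shiftGIso X 1) (add_zero 1)
  rwa [mk₀_comp_shiftGIso] at this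

/-- Two rotations give `-f⟦1⟧'`; the tautological isomorphisms of degree 1 turn it back into `f`,
and signs do not affect exactness. -/
lemma isExactAt_of_distTriang₃ {f : X ⟶ Y} {g : Y ⟶ Z} {h : Z ⟶ X⟦(1 : ℤ)⟧}
    (hT : Triangle.mk f g h ∈ distTriang C) :
    IsExactAt (h : ShiftedHom Z X (1 : ℤ)) (mk₀ (0 : ℤ) rfl f) := by
  have hT' : Triangle.mk g h (-f⟦(1 : ℤ)⟧') ∈ distTriang C := rot_of_distTriang _ hT
  have hT'' : Triangle.mk h (-f⟦(1 : ℤ)⟧') (-g⟦(1 : ℤ)⟧') ∈ distTriang C :=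
    rot_of_distTriang _ hT'
  have h := (((isExactAt_of_distTriang hT'').conj_iso
    (shiftGIso X 1) (add_zero 1) (zero_add (-1))).comp_iso (shiftGIso Y 1)
    (c := 0) (by lia)).neg_right
  rw [mk₀_comp_shiftGIso, assoc_r 1 (by lia)] at h
  simp only [mk₀_neg, neg_comp, comp_neg, neg_neg] at h
  rwa [shiftGIso_naturality _ _ _ (by lia), GIso.inv_hom_comp] at h

/-- The pair `α`, `β` is completed to a morphism from the triangle to its shift by `d`; the
hypothesis `hd` removes the signs (-1)^d in the shifted triangle. -/
lemma exists_endo_of_distTriang {f : X ⟶ Y} {g : Y ⟶ Z} {h : Z ⟶ X⟦(1 : ℤ)⟧}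
    (hT : Triangle.mk f g h ∈ distTriang C) {d : ℤ}
    (hd : ∀ {X Y : C} (f : X ⟶ Y), d.negOnePow • f = f) (α : ShiftedHom X X d)
    (β : ShiftedHom Y Y d)
    (hf : (mk₀ (0 : ℤ) rfl f).comp β (add_zero d) = α.comp (mk₀ (0 : ℤ) rfl f) (zero_add d)) :
    ∃ γ : ShiftedHom Z Z d,
      (mk₀ (0 : ℤ) rfl g).comp γ (add_zero d) = β.comp (mk₀ (0 : ℤ) rfl g) (zero_add d) ∧
      ∀ {c : ℤ} (h₁ : d + 1 = c) (h₂ : 1 + d = c),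
        ShiftedHom.comp (X := Z) (Y := X) h α h₁ = γ.comp (Y := Z) (Z := X) h h₂ := by
  simp only [mk₀_comp, comp_mk₀] at hf ⊢
  obtain ⟨(γ : Z ⟶ Z⟦d⟧), (h1 : g ≫ γ = β ≫ (d.negOnePow • g⟦d⟧')),
    (h2 : h ≫ α⟦(1 : ℤ)⟧' = γ ≫ (d.negOnePow • (h⟦d⟧' ≫ (shiftFunctorComm C 1 d).hom.app X)))⟩ :=
    complete_distinguished_triangle_morphism _ _ hT
    (Triangle.shift_distinguished _ hT d) α β
    (show f ≫ β = α ≫ (d.negOnePow • f⟦d⟧') by rw [hd]; exact hf)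
  rw [hd] at h1 h2
  refine ⟨γ, h1, ?_⟩
  intro c h₁ h₂
  rw [comp, comp, reassoc_of% h2]
  simp [shiftFunctorComm_eq C 1 d c h₂]

/-- Every shifted morphism fits in an exact triangle, and commuting endomorphisms extend to it. -/
lemma exists_cone {n : ℤ} (f : ShiftedHom X Y n) :
    ∃ (Z : C) (q : ShiftedHom Y Z (-n)) (δ : ShiftedHom Z X (1 : ℤ)),
      IsExactAt f q ∧ IsExactAt q δ ∧ IsExactAt δ f ∧
      ∀ {d : ℤ} (_ : ∀ {X Y : C} (f : X ⟶ Y), d.negOnePow • f = f) {e : ℤ} (he : d + n = e)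
        (he' : n + d = e) (α : ShiftedHom X X d) (β : ShiftedHom Y Y d),
        f.comp β he = α.comp f he' → ∃ γ : ShiftedHom Z Z d,
          (∀ {c : ℤ} (h₁ : d + -n = c) (h₂ : -n + d = c), q.comp γ h₁ = β.comp q h₂) ∧
          ∀ {c : ℤ} (h₁ : d + 1 = c) (h₂ : 1 + d = c), δ.comp α h₁ = γ.comp δ h₂ := by
  -- The cone is taken of `f` as an ordinary morphism to `Y⟦n⟧`, which is then traded for `Y` along
  -- `shiftGIso Y n`.
  obtain ⟨Z, b, c, hT⟩ := distinguished_cocone_triangle f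
  have h1 := (isExactAt_of_distTriang hT).conj_iso (shiftGIso Y n) (add_zero n) (zero_add (-n))
  have h2 := (isExactAt_of_distTriang₂ hT).iso_comp (shiftGIso Y n).symm (zero_add (-n))
  have h3 := (isExactAt_of_distTriang₃ hT).comp_iso (shiftGIso Y n) (add_zero n)
  rw [mk₀_comp_shiftGIso] at h1 h3
  refine ⟨Z, _, c, h1, h2, h3, ?_⟩
  intro d hd e he he' α β h
  let i := shiftGIso Y n
  obtain ⟨γ, hγ, hγ'⟩ := exists_endo_of_distTriang hT (d := d) hd α
    (i.hom.comp (β.comp i.inv (c := d + -n) (by lia)) (by lia)) (by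
      rw [assoc_l n (by lia), mk₀_comp_shiftGIso, assoc_l e he, h, assoc_r 0 (by lia)]
      congr 1
      have := (shiftGIso Y n).comp_hom_inv (mk₀ (Y := Y⟦n⟧) (0 : ℤ) rfl f) (add_zero n) (by lia)
      rwa [mk₀_comp_shiftGIso] at this)
  refine ⟨γ, ?_, hγ'⟩
  intro c h₁ h₂
  rw [assoc_r d (by lia), hγ, assoc_r c (by lia), GIso.inv_hom_comp, assoc_r (-n) (by lia)]

end CategoryTheory.ShiftedHom

/-! ### Central elements as families commuting with all shifted morphisms -/

namespace gradedCenter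

open ShiftedHom

section

variable {C : Type*} [Category* C] [HasShift C ℤ] [Preadditive C]

lemma units_smul_comp {X Y Z : C} {a b c : ℤ} (f : ShiftedHom X Y a) (g : ShiftedHom Y Z b)
    (ε : ℤˣ) (h : b + a = c) : (ε • f).comp g h = ε • f.comp g h := by
  obtain rfl | rfl := Int.units_eq_one_or ε <;> simp

/-- The commutation of `f`, up to the Koszul sign, with endomorphisms of degree `n`. -/
structure Commutes {n : ℤ} {X Y : C} (x : ShiftedHom X X n) (y : ShiftedHom Y Y n) {m : ℤ}
    (f : ShiftedHom X Y m) : Prop where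
  eq : ∀ {c : ℤ} (h₁ : m + n = c) (h₂ : n + m = c), x.comp f h₁ = (n * m).negOnePow • f.comp y h₂

variable [∀ n : ℤ, (shiftFunctor C n).Additive]

lemma comp_units_smul {X Y Z : C} {a b c : ℤ} (f : ShiftedHom X Y a) (g : ShiftedHom Y Z b)
    (ε : ℤˣ) (h : b + a = c) : f.comp (ε • g) h = ε • f.comp g h := by
  obtain rfl | rfl := Int.units_eq_one_or ε <;> simp

section

variable {n : ℤ} {X Y Z : C} {x : ShiftedHom X X n} {y : ShiftedHom Y Y n}
  {z : ShiftedHom Z Z n}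

lemma Commutes.comp {m p q : ℤ} {f : ShiftedHom X Y m}
    {g : ShiftedHom Y Z p} (hf : Commutes x y f) (hg : Commutes y z g) (h : p + m = q) :
    Commutes x z (f.comp g h) := by
  subst h
  refine ⟨fun {c} h₁ h₂ => ?_⟩
  rw [assoc_l (m + n) rfl, hf.eq rfl (by lia), units_smul_comp,
    assoc_r (p + n) rfl, hg.eq rfl (by lia), comp_units_smul,
    assoc_r (p + n) (by lia), smul_smul, ← Int.negOnePow_add]
  congr 2
  ring

lemma Commutes.inv {m p : ℤ} (f : GIso X Y m p) (hf : Commutes x y f.hom) :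
    Commutes y x f.inv := by
  refine ⟨fun {c} h₁ h₂ => ?_⟩
  have h0 := f.sum
  obtain rfl : p = -m := by lia
  obtain rfl : c = n + -m := by lia
  have := congrArg (fun u => (f.inv.comp u (c := n) (by lia)).comp f.inv (c := n + -m)
    (by lia)) (hf.eq rfl (by lia))
  simp only [comp_units_smul, units_smul_comp] at this
  rw [f.inv_hom_comp, assoc_l (n + -m) (by lia), f.comp_hom_inv] at this
  rw [show n * -m = -(n * m) by ring, Int.negOnePow_neg, this, smul_smul, Int.units_mul_self,
    one_smul]

end

variable {k : Type*} [Field k] [Linear k C] [∀ n : ℤ, (shiftFunctor C n).Linear k]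

/-- Naturality is commutation with morphisms of degree 0, and the sign condition is commutation with
the tautological isomorphism from `X⟦1⟧` to `X`. These and their inverses generate all shifted
morphisms under composition. -/
lemma app_commutes {n : ℤ} {η : 𝟭 C ⟶ shiftFunctor C n} (hη : η ∈ gradedCenter k C n) {X Y : C}
    {m : ℤ} (f : ShiftedHom X Y m) : Commutes (X := X) (Y := Y) (η.app X) (η.app Y) f := by
  let e : ∀ X : C, ShiftedHom X X n := fun X => η.app X
  have h0 : ∀ {X Y : C} (g : X ⟶ Y), Commutes (e X) (e Y) (mk₀ (0 : ℤ) rfl g) := by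
    intro X Y g
    refine ⟨fun {c} h₁ h₂ => ?_⟩
    obtain rfl : c = n := by lia
    simp only [mk₀_comp, comp_mk₀, e, mul_zero, Int.negOnePow_zero, one_smul]
    exact (η.naturality g).symm
  have h1 : ∀ X : C, Commutes (e _) (e X) (shiftGIso X 1).hom := by
    intro X
    refine ⟨fun {c} h₁ h₂ => ?_⟩
    have hX : e (X⟦(1 : ℤ)⟧) = n.negOnePow • ((e X)⟦(1 : ℤ)⟧' ≫ (shiftComm X n 1).hom) := hη X
    rw [hX, mul_one]
    erw [units_smul_comp]
    congr 1
    simp [shiftGIso, ShiftedHom.comp, shiftComm, shiftFunctorComm_eq C n 1 c h₂]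
  have key : ∀ (m : ℤ) (X : C), Commutes (e _) (e X) (shiftGIso X m).hom := by
    intro m
    have hs : ∀ (m : ℤ) (X : C), (shiftGIso X (m + 1)).hom =
        (mk₀ (0 : ℤ) rfl ((shiftFunctorAdd' C m 1 (m + 1) rfl).hom.app X)).comp
        ((shiftGIso (X⟦m⟧) 1).hom.comp (shiftGIso X m).hom rfl) (add_zero _) := by
      intro m X
      rw [mk₀_comp]
      simp [shiftGIso, ShiftedHom.comp]
    induction m using Int.induction_on with
    | zero =>
      intro X
      have : (shiftGIso X 0).hom = mk₀ (0 : ℤ) rfl ((shiftFunctorZero C ℤ).hom.app X) := by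
        simp [shiftGIso, mk₀, shiftFunctorZero']
      rw [this]
      exact h0 _
    | succ i hi =>
      intro X
      rw [hs]
      exact (h0 _).comp ((h1 _).comp (hi X) _) _
    | pred i hi =>
      intro X
      -- In negative degrees the recursion `hs` is solved for the smaller index, by inverting the
      -- isomorphism of degree 1.
      have h2 : (shiftGIso X (-(i : ℤ) - 1)).hom = (shiftGIso (X⟦(-(i : ℤ) - 1)⟧) 1).inv.comp
          ((mk₀ (0 : ℤ) rfl ((shiftFunctorAdd' C (-(i : ℤ) - 1) 1 (-i - 1 + 1) rfl).inv.app X)).comp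
            (shiftGIso X (-(i : ℤ) - 1 + 1)).hom (add_zero _)) (by lia) := by
        rw [hs (-(i : ℤ) - 1) X, mk₀_comp_mk₀_assoc, Iso.inv_hom_id_app, gid_comp,
          GIso.inv_hom_comp]
      rw [h2]
      refine (Commutes.inv _ (h1 _)).comp ((h0 _).comp ?_ _) _
      have : (-(i : ℤ) - 1 + 1) = -i := by lia
      rw [this]
      exact hi X
  have := (h0 (Y := Y⟦m⟧) f).comp (key m Y) (q := m) (by lia)
  rwa [mk₀_comp_shiftGIso f] at this

variable (k) in
/-- The element of the graded center given by a family commuting with all shifted morphisms. -/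
def ofFamily {n : ℤ} (e : ∀ X : C, ShiftedHom X X n)
    (he : ∀ {X Y : C} {m : ℤ} (f : ShiftedHom X Y m), Commutes (e X) (e Y) f) :
    gradedCenter k C n :=
  ⟨{ app := e
     naturality := fun X Y f => by
      have := (he (mk₀ (0 : ℤ) rfl f)).eq (zero_add n) (add_zero n)
      simp only [mk₀_comp, comp_mk₀, mul_zero, Int.negOnePow_zero, one_smul] at this
      exact this.symm }, fun X => by
    -- Unwound, commutation with the tautological isomorphism of degree 1 is the sign condition of
    -- the graded center.
    have := (he (shiftGIso X 1).hom).eq (c := 1 + n) rfl (by lia)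
    simp only [shiftGIso, mul_one, ShiftedHom.comp, Category.id_comp] at this
    erw [CategoryTheory.Functor.map_id, Category.id_comp] at this
    change e _ = n.negOnePow • ((e X)⟦(1 : ℤ)⟧' ≫ (shiftComm X n 1).hom)
    rw [← cancel_mono ((shiftFunctorAdd' C 1 n (1 + n) rfl).inv.app X), this]
    rw [Units.smul_def, Units.smul_def, Preadditive.zsmul_comp]
    congr 1
    simp [shiftComm, shiftFunctorComm_eq C n 1 (1 + n) (by lia)]⟩

end

end gradedCenter

/-! ### Extending central families from a generating family of objects -/

namespace CategoryTheory.ShiftedHom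

variable {C : Type*} [Category* C] [HasShift C ℤ] [Preadditive C]

/-- The finite sums of compositions of shifted morphisms through the objects of a family. -/
inductive FactorsThrough {I : Type*} (S : I → C) {X Y : C} {n : ℤ} : ShiftedHom X Y n → Prop
  | zero : FactorsThrough S 0
  | add {f g : ShiftedHom X Y n} : FactorsThrough S f → FactorsThrough S g →
      FactorsThrough S (f + g)
  | comp (i : I) {a b : ℤ} (f : ShiftedHom X (S i) a) (g : ShiftedHom (S i) Y b)
      (h : b + a = n) : FactorsThrough S (f.comp g h)

variable [∀ n : ℤ, (shiftFunctor C n).Additive]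

namespace FactorsThrough

variable {I : Type*} {S : I → C} {X Y Z : C} {n m p : ℤ}

lemma comp_right {f : ShiftedHom X Y n} (hf : FactorsThrough S f) (g : ShiftedHom Y Z m)
    (h : m + n = p) : FactorsThrough S (f.comp g h) := by
  induction hf with
  | zero => rw [zero_comp]; exact .zero
  | add _ _ h1 h2 => rw [add_comp]; exact .add h1 h2
  | @comp i a b f' g' h' => rw [assoc_r (m + b) rfl]; exact .comp i _ _ _

lemma comp_left {f : ShiftedHom X Y n} (hf : FactorsThrough S f) (g : ShiftedHom Z X m)
    (h : n + m = p) : FactorsThrough S (g.comp f h) := by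
  induction hf with
  | zero => rw [comp_zero]; exact .zero
  | add _ _ h1 h2 => rw [comp_add]; exact .add h1 h2
  | @comp i a b f' g' h' => rw [assoc_l (a + m) rfl]; exact .comp i _ _ _

lemma of_gid_right (hX : FactorsThrough S (gid Y)) (f : ShiftedHom X Y n) :
    FactorsThrough S f := by
  have := hX.comp_left f (zero_add n)
  rwa [comp_gid] at this

lemma comp_eq_zero {f : ShiftedHom X Y n} (hf : FactorsThrough S f) (g : ShiftedHom Y Z m)
    (hg : ∀ (i : I) (a c : ℤ) (u : ShiftedHom (S i) Y a) (h : m + a = c), u.comp g h = 0)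
    (h : m + n = p) : f.comp g h = 0 := by
  induction hf with
  | zero => rw [zero_comp]
  | add _ _ h1 h2 => rw [add_comp, h1, h2, zero_add]
  | @comp i a b f' g' h' => rw [assoc_r (m + b) rfl, hg, comp_zero]

/-- Shifted morphisms from `X` are detected by the family if the identity of `X` factors. -/
lemma eq_of_gid (hX : FactorsThrough S (gid X)) {f g : ShiftedHom X Y n}
    (hfg : ∀ (i : I) (a c : ℤ) (u : ShiftedHom (S i) X a) (h : n + a = c),
      u.comp f h = u.comp g h) : f = g := by
  rw [← sub_eq_zero, ← gid_comp (f - g) (add_zero n)]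
  refine hX.comp_eq_zero _ (fun i a c u h => ?_) _
  rw [sub_eq_add_neg, comp_add, comp_neg, hfg, add_neg_cancel]

end FactorsThrough

end CategoryTheory.ShiftedHom

namespace gradedCenter

open ShiftedHom

variable {C : Type*} [Category* C] [HasShift C ℤ] [Preadditive C]
  [∀ n : ℤ, (shiftFunctor C n).Additive] {I : Type*} {S : I → C} {n : ℤ}
  {e : ∀ i, ShiftedHom (S i) (S i) n}

/-- The endomorphism `x` plays the role of the product of `f` with the component sought at `X`: if
`f` is a sum of composites f' g' through the family, take the sum of the f' e g', signed by the cost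
of moving `e` past f'. The case of the identity gives the component itself. -/
lemma exists_extension
    (he : ∀ {i j : I} {m : ℤ} (f : ShiftedHom (S i) (S j) m), Commutes (e i) (e j) f)
    {X : C} {f : ShiftedHom X X (0 : ℤ)} (hf : FactorsThrough S f) :
    ∃ x : ShiftedHom X X n, ∀ (i : I) (p c : ℤ) (u : ShiftedHom (S i) X p) (h : n + p = c)
      (h' : p + n = c) (h'' : 0 + p = p),
      u.comp x h = (n * p).negOnePow • (e i).comp (u.comp f h'') h' := by
  induction hf with
  | zero => exact ⟨0, fun i p c u h h' h'' => by simp⟩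
  | add _ _ h1 h2 =>
    obtain ⟨x, hx⟩ := h1
    obtain ⟨y, hy⟩ := h2
    refine ⟨x + y, fun i p c u h h' h'' => ?_⟩
    rw [comp_add, comp_add, comp_add, hx i p c u h h' h'', hy i p c u h h' h'', smul_add]
  | @comp j a b f g hab =>
    refine ⟨(n * a).negOnePow • f.comp ((e j).comp g (c := b + n) rfl) (by lia), ?_⟩
    intro i p c u h h' h''
    rw [comp_units_smul, assoc_l (a + p) rfl, assoc_l (n + (a + p)) rfl,
      assoc_l (a + p) (β := f) (γ := g) rfl, assoc_l (n + (a + p)) (by lia),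
      (he (u.comp f rfl)).eq _ rfl, units_smul_comp, smul_smul, ← Int.negOnePow_add]
    have : n * p + n * (a + p) = n * a + (n * p + n * p) := by ring
    rw [this, Int.negOnePow_add (n * a), Int.negOnePow_add (n * p), Int.units_mul_self, mul_one]

variable {k : Type*} [Field k] [Linear k C] [∀ n : ℤ, (shiftFunctor C n).Linear k]

variable (k) in
/-- A family of endomorphisms commuting with the shifted morphisms between the objects of a
generating family extends to the graded center. -/
lemma exists_of_family (hS : ∀ X : C, FactorsThrough S (gid X))
    (he : ∀ {i j : I} {m : ℤ} (f : ShiftedHom (S i) (S j) m), Commutes (e i) (e j) f) :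
    ∃ η : gradedCenter k C n, ∀ i, η.1.app (S i) = e i := by
  choose x hx using fun X => exists_extension he (hS X)
  have hx' : ∀ (X : C) (i : I) (p c : ℤ) (u : ShiftedHom (S i) X p) (h : n + p = c)
      (h' : p + n = c), u.comp (x X) h = (n * p).negOnePow • (e i).comp u h' := by
    intro X i p c u h h'
    rw [hx X i p c u h h' (zero_add p), comp_gid]
  refine ⟨ofFamily k x ?_, ?_⟩
  · intro X Y m f
    refine ⟨fun {c} h₁ h₂ => ?_⟩
    refine (hS X).eq_of_gid (fun i p q u h => ?_)
    rw [comp_units_smul, assoc_l (n + p) rfl, hx' X i p _ u _ (add_comm p n), units_smul_comp,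
      assoc_l (m + p) rfl, hx' Y i _ _ _ _ (by lia), smul_smul, ← Int.negOnePow_add,
      assoc_r (m + p) rfl]
    congr 1
    have : n * m + n * (m + p) = n * p + (n * m + n * m) := by ring
    rw [this, Int.negOnePow_add (n * p), Int.negOnePow_add (n * m), Int.units_mul_self, mul_one]
  · intro i
    have := hx' (S i) i 0 n (gid _) (add_zero n) (zero_add n)
    change x (S i) = e i
    simpa only [gid_comp, comp_gid, mul_zero, Int.negOnePow_zero, one_smul] using this

/-- Commutation with the morphisms `u` from the family to `X` determines their composites with the
component at `X`, and such composites detect morphisms out of `X`. -/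
lemma ext_of_family (hS : ∀ X : C, FactorsThrough S (gid X)) {η ζ : gradedCenter k C n}
    (h : ∀ i, η.1.app (S i) = ζ.1.app (S i)) : η = ζ := by
  refine hext fun X => ?_
  refine (hS X).eq_of_gid (n := n) (f := η.1.app X) (g := ζ.1.app X) (fun i p q u hq => ?_)
  have h1 := (app_commutes η.2 u).eq (c := q) (by lia) hq
  have h2 := (app_commutes ζ.2 u).eq (c := q) (by lia) hq
  rw [h, h2] at h1
  exact (smul_left_cancel _ h1).symm

end gradedCenter

namespace gradedCenter

open ShiftedHom Pretriangulated

section Commutes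

variable {C : Type*} [Category* C] [HasShift C ℤ] [Preadditive C] {n m : ℤ} {X Y : C}
  {x : ShiftedHom X X n} {y : ShiftedHom Y Y n}

lemma Commutes.smul {k : Type*} [Field k] [Linear k C] [∀ n : ℤ, (shiftFunctor C n).Linear k]
    {f : ShiftedHom X Y m} (h : Commutes x y f) (c : k) : Commutes x y (c • f) :=
  ⟨fun h₁ h₂ => by
    rw [ShiftedHom.comp_smul, ShiftedHom.smul_comp, h.eq h₁ h₂]
    exact smul_comm _ _ _⟩

end Commutes

end gradedCenter

/-! ### Generators with polynomial endomorphism ring and the cones of powers of z -/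

namespace CategoryTheory.ShiftedHom

open Pretriangulated gradedCenter

variable (k : Type*) [Field k] {C : Type*} [Category* C] [HasShift C ℤ] [Preadditive C]
  [Linear k C] [∀ n : ℤ, (shiftFunctor C n).Additive] [∀ n : ℤ, (shiftFunctor C n).Linear k]
  [Limits.HasZeroObject C] [Pretriangulated C]

/-- A generator of a triangulated category whose graded endomorphism ring is a polynomial ring
in one variable of degree `1`, with powers `z n`. -/
structure PolynomialGenerator (G : C) where
  z : ∀ n : ℤ, ShiftedHom G G n
  z_zero : z 0 = gid G
  z_comp_z : ∀ {a b c : ℤ} (_ : 0 ≤ a) (_ : 0 ≤ b) (h : b + a = c), (z a).comp (z b) h = z c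
  z_ne_zero : ∀ {n : ℤ}, 0 ≤ n → z n ≠ 0
  eq_zero : ∀ {n : ℤ}, n < 0 → ∀ f : ShiftedHom G G n, f = 0
  exists_smul : ∀ {n : ℤ} (f : ShiftedHom G G n), ∃ c : k, f = c • z n
  generates : ∀ P : C → Prop, P G → (∀ {X Y : C} {n m : ℤ}, GIso X Y n m → P X → P Y) →
    (∀ {X Y Z : C} (f : X ⟶ Y) (g : Y ⟶ Z) (h : Z ⟶ X⟦(1 : ℤ)⟧),
      Triangle.mk f g h ∈ distTriang C → P X → P Z → P Y) → ∀ X, P X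

namespace PolynomialGenerator

variable {k} {G : C} (Γ : PolynomialGenerator k G)

include Γ in
lemma z_comm {a b c : ℤ} (h : b + a = c) (h' : a + b = c) :
    (Γ.z a).comp (Γ.z b) h = (Γ.z b).comp (Γ.z a) h' := by
  obtain ha | ha := lt_or_ge a 0
  · rw [Γ.eq_zero ha (Γ.z a)]; simp
  obtain hb | hb := lt_or_ge b 0
  · rw [Γ.eq_zero hb (Γ.z b)]; simp
  rw [Γ.z_comp_z ha hb, Γ.z_comp_z hb ha]

/-- A cone of the power `z s`. -/
structure Cone (s : ℤ) where
  X : C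
  π : ShiftedHom G X (-s)
  ι : ShiftedHom X G (1 : ℤ)
  exact₁ : IsExactAt (Γ.z s) π
  exact₂ : IsExactAt π ι
  exact₃ : IsExactAt ι (Γ.z s)
  exists_endo : ∀ {d : ℤ}, (∀ {X Y : C} (f : X ⟶ Y), d.negOnePow • f = f) →
    ∃ γ : ShiftedHom X X d,
      (∀ {c : ℤ} (h₁ : d + -s = c) (h₂ : -s + d = c), π.comp γ h₁ = (Γ.z d).comp π h₂) ∧
      ∀ {c : ℤ} (h₁ : d + 1 = c) (h₂ : 1 + d = c), ι.comp (Γ.z d) h₁ = γ.comp ι h₂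

lemma nonempty_cone (s : ℤ) : Nonempty (Γ.Cone s) := by
  obtain ⟨X, q, δ, h1, h2, h3, h4⟩ := exists_cone (Γ.z s)
  exact ⟨⟨X, q, δ, h1, h2, h3, fun {d} hd =>
    h4 hd rfl (add_comm s d) (Γ.z d) (Γ.z d) (Γ.z_comm _ _)⟩⟩

variable {Γ}

namespace Cone

variable {s t : ℤ} (A : Γ.Cone s) (B : Γ.Cone t)

-- The composite of `u` with `ι` is a multiple of a power of z and is killed by z^s. As k[z] is a
-- domain it is zero, so `u` lifts along `π`.
include A in
lemma exists_of_to (hs : 0 ≤ s) {m j : ℤ} (u : ShiftedHom G A.X m) (h : -s + j = m) :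
    ∃ c : k, u = c • (Γ.z j).comp A.π h := by
  have h0 : u.comp A.ι (c := m + 1) (by lia) = 0 := by
    obtain hm | hm := lt_or_ge (m + 1) 0
    · exact Γ.eq_zero hm _
    · obtain ⟨c, hc⟩ := Γ.exists_smul (u.comp A.ι (c := m + 1) (by lia))
      have h1 : (u.comp A.ι (c := m + 1) (by lia)).comp (Γ.z s) (c := s + (m + 1)) rfl = 0 := by
        rw [assoc_r (s + 1) rfl, A.exact₃.zero, comp_zero]
      rw [hc, smul_comp, Γ.z_comp_z hm hs, smul_eq_zero] at h1
      rw [hc, h1.resolve_right (Γ.z_ne_zero (by lia)), zero_smul]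
  obtain ⟨v, rfl⟩ := A.exact₂.lift u h _ h0
  obtain ⟨c, rfl⟩ := Γ.exists_smul v
  exact ⟨c, smul_comp _ _ _ _⟩

include A in
lemma exists_of_from (hs : 0 ≤ s) {m j : ℤ} (u : ShiftedHom A.X G m) (h : j + 1 = m) :
    ∃ c : k, u = c • A.ι.comp (Γ.z j) h := by
  have h0 : A.π.comp u (c := m + -s) rfl = 0 := by
    obtain hm | hm := lt_or_ge (m + -s) 0
    · exact Γ.eq_zero hm _
    · obtain ⟨c, hc⟩ := Γ.exists_smul (A.π.comp u (c := m + -s) rfl)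
      have h1 : (Γ.z s).comp (A.π.comp u (c := m + -s) rfl) rfl = 0 := by
        rw [assoc_l (-s + s) rfl, A.exact₁.zero, zero_comp]
      rw [hc, comp_smul, Γ.z_comp_z hs hm, smul_eq_zero] at h1
      rw [hc, h1.resolve_right (Γ.z_ne_zero (by lia)), zero_smul]
  obtain ⟨v, rfl⟩ := A.exact₂.desc u h _ h0
  obtain ⟨c, rfl⟩ := Γ.exists_smul v
  exact ⟨c, comp_smul _ _ _ _⟩

lemma z_comp_π_eq_zero (hs : 0 ≤ s) {j m : ℤ} (hj : s ≤ j) (h : -s + j = m) :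
    (Γ.z j).comp A.π h = 0 := by
  rw [← Γ.z_comp_z (a := j - s) (b := s) (by lia) hs (by lia), assoc_r (-s + s) rfl,
    A.exact₁.zero, comp_zero]

lemma ι_comp_z_eq_zero (hs : 0 ≤ s) {j m : ℤ} (hj : s ≤ j) (h : j + 1 = m) :
    A.ι.comp (Γ.z j) h = 0 := by
  rw [← Γ.z_comp_z (a := s) (b := j - s) hs (by lia) (by lia), assoc_l (s + 1) rfl,
    A.exact₃.zero, zero_comp]

lemma z_comp_π_ne_zero {j m : ℤ} (hj : 0 ≤ j) (hj' : j < s) (h : -s + j = m) :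
    (Γ.z j).comp A.π h ≠ 0 := by
  intro h0
  obtain ⟨v, hv⟩ := A.exact₁.lift (Γ.z j) (n := j - s) (by lia) h h0
  rw [Γ.eq_zero (by lia) v, zero_comp] at hv
  exact Γ.z_ne_zero hj hv

lemma ι_comp_z_ne_zero {j m : ℤ} (hj : 0 ≤ j) (hj' : j < s) (h : j + 1 = m) :
    A.ι.comp (Γ.z j) h ≠ 0 := by
  intro h0
  obtain ⟨v, hv⟩ := A.exact₃.desc (Γ.z j) (n := j - s) (by lia) h h0
  rw [Γ.eq_zero (by lia) v, comp_zero] at hv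
  exact Γ.z_ne_zero hj hv

/-- The compositions `X ⟶ G ⟶ G ⟶ Y` between two cones. -/
noncomputable def link (j : ℤ) {m : ℤ} (h : -t + (j + 1) = m) : ShiftedHom A.X B.X m :=
  (A.ι.comp (Γ.z j) rfl).comp B.π h

lemma link_eq_zero (hs : 0 ≤ s) (ht : 0 ≤ t) {j m : ℤ} (hj : j < 0 ∨ s ≤ j ∨ t ≤ j)
    (h : -t + (j + 1) = m) : A.link B j h = 0 := by
  obtain hj | hj | hj := hj
  · rw [link, Γ.eq_zero hj (Γ.z j)]; simp
  · rw [link, A.ι_comp_z_eq_zero hs hj, zero_comp]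
  · rw [link, assoc_r (-t + j) rfl, B.z_comp_π_eq_zero ht hj, comp_zero]

lemma link_ne_zero {j m : ℤ} (hj : 0 ≤ j) (hjs : j < s) (hjt : j < t)
    (h : -t + (j + 1) = m) : A.link B j h ≠ 0 := by
  intro h0
  rw [link, assoc_r (-t + j) rfl] at h0
  -- Otherwise z^j π would be z^s v with `v` a multiple of z^(j-s) π, which is zero because j < s.
  obtain ⟨v, hv⟩ := A.exact₃.desc _ (n := -t + j - s) (by lia) _ h0
  obtain ⟨c, rfl⟩ := B.exists_of_to (by lia) v (j := j - s) (by lia)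
  rw [Γ.eq_zero (by lia) (Γ.z (j - s)), zero_comp, smul_zero, comp_zero] at hv
  exact B.z_comp_π_ne_zero hj hjt rfl hv

variable {A B}

lemma exists_link_of_comp_ι (hs : 0 ≤ s) {m j c : ℤ} (f : ShiftedHom A.X B.X m)
    (h : -t + (j + 1) = m) (h' : 1 + m = c) (hf : f.comp B.ι h' = 0) :
    ∃ c : k, f = c • A.link B j h := by
  obtain ⟨v, rfl⟩ := B.exact₂.lift f h h' hf
  obtain ⟨c, rfl⟩ := A.exists_of_from hs v rfl
  exact ⟨c, smul_comp _ _ _ _⟩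

/-- Composing `f` with `B.ι` gives a multiple of `A.ι` followed by z^m, which vanishes for m < 0. -/
lemma exists_link_of_neg (hs : 0 ≤ s) {m j : ℤ} (hm : m < 0) (f : ShiftedHom A.X B.X m)
    (h : -t + (j + 1) = m) : ∃ c : k, f = c • A.link B j h := by
  refine exists_link_of_comp_ι hs f h (c := m + 1) (by lia) ?_
  obtain ⟨c, hc⟩ := A.exists_of_from hs (f.comp B.ι (c := m + 1) (by lia)) rfl
  rw [hc, Γ.eq_zero hm (Γ.z m), comp_zero, smul_zero]

variable (A)

/-- The endomorphism of degree `0` spanning the socle. -/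
noncomputable def socle : ShiftedHom A.X A.X (0 : ℤ) := A.link A (s - 1) (by lia)

lemma socle_comp_ι {c : ℤ} (h : 1 + 0 = c) : A.socle.comp A.ι h = 0 := by
  rw [socle, link, assoc_r (1 + -s) rfl, A.exact₂.zero, comp_zero]

lemma π_comp_socle {c : ℤ} (h : 0 + -s = c) : A.π.comp A.socle h = 0 := by
  rw [socle, link, assoc_r (-s + (s - 1)) (by lia), assoc_l (1 + -s) (by lia), A.exact₂.zero,
    zero_comp]

lemma socle_comp_socle {c : ℤ} (h : 0 + 0 = c) : A.socle.comp A.socle h = 0 := by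
  conv_lhs => enter [2]; rw [socle, link, assoc_r (-s + (s - 1)) (by lia)]
  rw [assoc_l (1 + 0) (by lia), socle_comp_ι, zero_comp]

lemma socle_ne_zero (hs : 0 < s) : A.socle ≠ 0 :=
  link_ne_zero A A (by lia) (by lia) (by lia) _

end Cone

end PolynomialGenerator

end CategoryTheory.ShiftedHom

/-! ### Central families on the generator and the cones -/

namespace CategoryTheory.ShiftedHom

open Pretriangulated gradedCenter

variable {k : Type*} [Field k] {C : Type*} [Category* C] [HasShift C ℤ] [Preadditive C]
  [Linear k C] [∀ n : ℤ, (shiftFunctor C n).Additive] [∀ n : ℤ, (shiftFunctor C n).Linear k]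
  [Limits.HasZeroObject C] [Pretriangulated C]

namespace PolynomialGenerator

variable {G : C} {Γ : PolynomialGenerator k G} (K : ∀ r : ℕ, Γ.Cone (r + 1))

/-- The generator and the cones of the powers of `z`. -/
def objs : Option ℕ → C
  | none => G
  | some r => (K r).X

/-- A family of endomorphisms of the generator and of the cones. -/
def family {n : ℤ} (g : ShiftedHom G G n) (x : ∀ r, ShiftedHom (K r).X (K r).X n) :
    ∀ i, ShiftedHom (objs K i) (objs K i) n
  | none => g
  | some r => x r

variable {K}

/-- Up to scalars, every morphism to or from `G`, and every morphism of negative degree between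
cones, is a composite of z's, `π` and `ι`. Only nonnegative degrees between cones need a separate
hypothesis. -/
lemma commutes_family {n : ℤ} {g : ShiftedHom G G n} {x : ∀ r, ShiftedHom (K r).X (K r).X n}
    (hz : ∀ j, Commutes g g (Γ.z j)) (hπ : ∀ r, Commutes g (x r) (K r).π)
    (hι : ∀ r, Commutes (x r) g (K r).ι)
    (hx : ∀ (r s : ℕ) (m : ℤ) (f : ShiftedHom (K r).X (K s).X m), 0 ≤ m →
      Commutes (x r) (x s) f) {i j : Option ℕ} {m : ℤ} (f : ShiftedHom (objs K i) (objs K j) m) :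
    Commutes (family K g x i) (family K g x j) f := by
  match i, j, f with
  | none, none, f =>
    obtain ⟨c, rfl⟩ := Γ.exists_smul f
    exact (hz m).smul c
  | none, some r, f =>
    obtain ⟨c, rfl⟩ := (K r).exists_of_to (by lia) f (j := m + (r + 1)) (by lia)
    exact ((hz _).comp (hπ r) _).smul c
  | some r, none, f =>
    obtain ⟨c, rfl⟩ := (K r).exists_of_from (by lia) f (j := m - 1) (by lia)
    exact ((hι r).comp (hz _) _).smul c
  | some r, some s, f =>
    obtain hm | hm := lt_or_ge m 0
    · obtain ⟨c, rfl⟩ := Cone.exists_link_of_neg (A := K r) (B := K s) (by lia) hm f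
        (j := m + s) (by lia)
      exact (((hι r).comp (hz _) _).comp (hπ s) _).smul c
    · exact hx r s m f hm

lemma negOnePow_mul_smul {d : ℤ} (hd : ∀ {X Y : C} (f : X ⟶ Y), d.negOnePow • f = f) (m : ℤ)
    {X Y : C} (f : X ⟶ Y) : (d * m).negOnePow • f = f := by
  obtain h | h := Int.even_or_odd d
  · rw [Int.negOnePow_even _ (h.mul_right m), one_smul]
  · obtain h' | h' := Int.even_or_odd m
    · rw [Int.negOnePow_even _ (h'.mul_left d), one_smul]
    · have := hd f
      rw [Int.negOnePow_odd _ h] at this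
      rw [Int.negOnePow_odd _ (h.mul h')]
      exact this

/-- Both composites agree after `B.ι`, since `f` followed by `B.ι` is a multiple of `A.ι` followed
by z^m. Their difference is thus a multiple of a link whose exponent m + d + t - 1 is at least t
because d > 0, and such a link is zero. -/
lemma Cone.commutes_endo {d s t : ℤ} (hd : ∀ {X Y : C} (f : X ⟶ Y), d.negOnePow • f = f)
    (hd' : 0 < d) (hs : 0 ≤ s) (ht : 0 ≤ t) {A : Γ.Cone s} {B : Γ.Cone t}
    {x : ShiftedHom A.X A.X d} {y : ShiftedHom B.X B.X d} (hx : Commutes x (Γ.z d) A.ι)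
    (hy : Commutes y (Γ.z d) B.ι) {m : ℤ} (hm : 0 ≤ m) (f : ShiftedHom A.X B.X m) :
    Commutes x y f := by
  refine ⟨fun {c} h₁ h₂ => ?_⟩
  rw [negOnePow_mul_smul hd, ← sub_eq_zero]
  obtain ⟨a, ha⟩ := A.exists_of_from hs (f.comp B.ι (c := m + 1) (by lia)) rfl
  have h0 : (x.comp f h₁ - f.comp y h₂).comp B.ι (c := 1 + c) rfl = 0 := by
    have e1 := hx.eq (c := 1 + d) rfl (by lia)
    have e2 := hy.eq (c := 1 + d) rfl (by lia)
    rw [negOnePow_mul_smul hd] at e1 e2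
    rw [sub_eq_add_neg, add_comp, neg_comp, assoc_r (m + 1) (by lia), ha,
      assoc_r (α := f) (1 + d) (by lia), e2, assoc_l (m + 1) (by lia), ha, comp_smul, smul_comp,
      assoc_l (1 + d) (by lia), e1, assoc_r (m + d) (by lia), assoc_r (m + d) (by lia),
      Γ.z_comm (by lia), add_neg_cancel]
    lia
  obtain ⟨b, hb⟩ := exists_link_of_comp_ι (A := A) (B := B) hs (x.comp f h₁ - f.comp y h₂)
    (j := c + t - 1) (by lia) _ h0
  rw [hb, A.link_eq_zero B hs ht (by lia), smul_zero]

variable (K) in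
/-- Powers of `z` with trivial Koszul sign extend to central families. -/
lemma exists_family_z {d : ℤ} (hd : ∀ {X Y : C} (f : X ⟶ Y), d.negOnePow • f = f)
    (hd' : 0 < d) :
    ∃ x : ∀ r, ShiftedHom (K r).X (K r).X d, (∀ r, Commutes (Γ.z d) (x r) (K r).π) ∧
      ∀ {i j : Option ℕ} {m : ℤ} (f : ShiftedHom (objs K i) (objs K j) m),
        Commutes (family K (Γ.z d) x i) (family K (Γ.z d) x j) f := by
  choose x hx hx' using fun r => (K r).exists_endo (d := d) hd
  have hπ : ∀ r, Commutes (Γ.z d) (x r) (K r).π := fun r => ⟨fun h₁ h₂ => by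
    rw [negOnePow_mul_smul hd, hx r h₂ h₁]⟩
  have hι : ∀ r, Commutes (x r) (Γ.z d) (K r).ι := fun r => ⟨fun h₁ h₂ => by
    rw [negOnePow_mul_smul hd, hx' r h₂ h₁]⟩
  refine ⟨x, hπ, fun f => commutes_family (fun j => ⟨fun h₁ h₂ => ?_⟩) hπ hι ?_ f⟩
  · rw [negOnePow_mul_smul hd, Γ.z_comm]
  · intro r s m f hm
    exact Cone.commutes_endo hd hd' (by positivity) (by positivity) (hι r) (hι s) hm f

/-- Since `A.π` followed by `f` is a multiple of z^(m-s+t) `B.π`, the composite is a multiple of the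
link with exponent m + t - 1. The exponent is at least t if m > 0, and at least s if m = 0 and t >
s; if m = 0 and t < s, already z^(m-s+t) is zero. -/
lemma Cone.socle_comp_eq_zero {s t : ℤ} (hs : 0 < s) (ht : 0 < t) {A : Γ.Cone s} {B : Γ.Cone t}
    {m c : ℤ} (hm : 0 ≤ m) (hst : ¬ (m = 0 ∧ s = t)) (f : ShiftedHom A.X B.X m)
    (h : m + 0 = c) : A.socle.comp f h = 0 := by
  obtain ⟨a, ha⟩ := B.exists_of_to ht.le (A.π.comp f (c := m + -s) rfl) (j := m - s + t) (by lia)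
  rw [socle, link, assoc_r (m + -s) rfl, ha, comp_smul]
  obtain h0 | h0 := lt_or_ge (m - s + t) 0
  · rw [Γ.eq_zero h0 (Γ.z _)]; simp
  · rw [assoc_l (m - s + t + (s - 1 + 1)) rfl, assoc_r (α := A.ι) (m + t - 1) (by lia),
      Γ.z_comp_z (by lia) h0 (by lia)]
    have := A.link_eq_zero B hs.le ht.le (j := m + t - 1) (m := c) (by lia) (by lia)
    rw [link] at this
    rw [show (A.ι.comp (Γ.z (m + t - 1)) (c := m - s + t + (s - 1 + 1)) (by lia)).comp B.π
      (c := c) (by lia) = 0 from ?_, smul_zero]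
    rw [← this]
    congr 1 <;> lia

lemma Cone.comp_socle_eq_zero {s t : ℤ} (hs : 0 < s) (ht : 0 < t) {A : Γ.Cone s} {B : Γ.Cone t}
    {m c : ℤ} (hm : 0 ≤ m) (hst : ¬ (m = 0 ∧ s = t)) (f : ShiftedHom A.X B.X m)
    (h : 0 + m = c) : f.comp B.socle h = 0 := by
  obtain ⟨a, ha⟩ := A.exists_of_from hs.le (f.comp B.ι (c := 1 + m) rfl) (j := m) (by lia)
  by_cases h0 : m + t - 1 < t ∧ m + t - 1 < s
  -- Here m = 0 and t < s, and the link is nonzero. Instead the coefficient `a` vanishes: `B.ι` is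
  -- killed by z^t whereas `A.ι` is not.
  · have : (f.comp B.ι (c := 1 + m) rfl).comp (Γ.z t) (c := t + (1 + m)) rfl = 0 := by
      rw [assoc_r (t + 1) rfl, B.exact₃.zero, comp_zero]
    rw [ha, smul_comp, assoc_r (t + m) rfl, Γ.z_comp_z hm ht.le, smul_eq_zero] at this
    have hz := this.resolve_right (A.ι_comp_z_ne_zero (by lia) (by lia) _)
    rw [socle, link, assoc_l (t - 1 + 1 + m) rfl, assoc_l (1 + m) rfl, ha, hz, zero_smul,
      zero_comp, zero_comp]
  · rw [socle, link, assoc_l (t - 1 + 1 + m) rfl, assoc_l (1 + m) rfl, ha, smul_comp,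
      assoc_r (m + t - 1) (by lia), Γ.z_comp_z hm (by lia), smul_comp]
    have := A.link_eq_zero B hs.le ht.le (j := m + t - 1) (m := c) (by lia) (by lia)
    rw [link] at this
    rw [show (A.ι.comp (Γ.z (m + t - 1)) (c := t - 1 + 1 + m) (by lia)).comp B.π
      (c := c) (by lia) = 0 from ?_, smul_zero]
    rw [← this]
    congr 1 <;> lia

/-- The endomorphisms of degree 0 are spanned by the identity and the socle. -/
lemma Cone.commutes_socle {s : ℤ} (hs : 0 < s) (A : Γ.Cone s) (f : ShiftedHom A.X A.X (0 : ℤ)) :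
    A.socle.comp f (add_zero 0) = f.comp A.socle (zero_add 0) := by
  obtain ⟨a, ha⟩ := A.exists_of_from hs.le (f.comp A.ι (c := 1) rfl) (j := 0) (by lia)
  rw [Γ.z_zero, comp_gid] at ha
  obtain ⟨b, hb⟩ := Cone.exists_link_of_comp_ι (A := A) (B := A) hs.le (f - a • gid A.X)
    (j := s - 1) (c := 1) (by lia) (by lia) (by
      rw [sub_eq_add_neg, add_comp, neg_comp, ha, smul_comp, gid_comp, add_neg_cancel])
  rw [← Cone.socle, sub_eq_iff_eq_add] at hb
  rw [hb]
  simp only [add_comp, comp_add, smul_comp, comp_smul, gid_comp, comp_gid]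

variable (K) in
lemma commutes_family_socle (c : ℕ → k) {i j : Option ℕ} {m : ℤ}
    (f : ShiftedHom (objs K i) (objs K j) m) :
    Commutes (family K 0 (fun r => c r • (K r).socle) i)
      (family K 0 (fun r => c r • (K r).socle) j) f := by
  refine commutes_family (fun j => ⟨fun h₁ h₂ => ?_⟩) (fun r => ⟨fun h₁ h₂ => ?_⟩)
    (fun r => ⟨fun h₁ h₂ => ?_⟩) (fun r s m f hm => ⟨fun {p} h₁ h₂ => ?_⟩) f
  · simp
  · rw [comp_smul, Cone.π_comp_socle]; simp
  · rw [smul_comp, Cone.socle_comp_ι]; simp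
  · rw [zero_mul, Int.negOnePow_zero, one_smul, smul_comp, comp_smul]
    by_cases h0 : m = 0 ∧ r = s
    · obtain ⟨rfl, rfl⟩ := h0
      obtain rfl : p = 0 := by lia
      rw [Cone.commutes_socle (by lia)]
    · rw [Cone.socle_comp_eq_zero (by lia) (by lia) hm (by lia),
        Cone.comp_socle_eq_zero (by lia) (by lia) hm (by lia), smul_zero, smul_zero]

end PolynomialGenerator

end CategoryTheory.ShiftedHom

/-! ### Constraints on the components of a central element -/

namespace CategoryTheory.ShiftedHom

open Pretriangulated gradedCenter

variable {k : Type*} [Field k] {C : Type*} [Category* C] [HasShift C ℤ] [Preadditive C]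
  [Linear k C] [∀ n : ℤ, (shiftFunctor C n).Additive] [∀ n : ℤ, (shiftFunctor C n).Linear k]

/-- The component at `X` of an element of the graded center. -/
def component {n : ℤ} (η : gradedCenter k C n) (X : C) : ShiftedHom X X n := η.1.app X

lemma component_commutes {n m : ℤ} (η : gradedCenter k C n) {X Y : C} (f : ShiftedHom X Y m) :
    Commutes (component η X) (component η Y) f :=
  app_commutes η.2 f

variable [Limits.HasZeroObject C] [Pretriangulated C]

namespace PolynomialGenerator

variable {G : C} {Γ : PolynomialGenerator k G} (K : ∀ r : ℕ, Γ.Cone (r + 1))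

-- Commuting with z, of degree 1, costs the sign -1, so the coefficient c of z^n satisfies 2c = 0.
include Γ in
lemma component_generator_eq_zero_of_odd (h2 : (2 : k) ≠ 0) {n : ℤ} (hn : Odd n)
    (η : gradedCenter k C n) : component η G = 0 := by
  obtain h0 | h0 := lt_or_ge n 0
  · exact Γ.eq_zero h0 _
  obtain ⟨c, hc⟩ := Γ.exists_smul (component η G)
  have := (component_commutes η (Γ.z 1)).eq (c := n + 1) (add_comm 1 n) rfl
  rw [hc, smul_comp, comp_smul, Γ.z_comp_z h0 (by lia), Γ.z_comp_z (by lia) h0, mul_one,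
    Int.negOnePow_odd n hn, Units.neg_smul, one_smul, eq_neg_iff_add_eq_zero, ← add_smul,
    smul_eq_zero, ← two_mul] at this
  rw [hc, (mul_eq_zero.1 (this.resolve_right (Γ.z_ne_zero (by lia)))).resolve_left h2, zero_smul]

lemma exists_component_eq_link {n j : ℤ} (η : gradedCenter k C n) (h0 : component η G = 0)
    {s : ℤ} (hs : 0 ≤ s) (A : Γ.Cone s) (h : -s + (j + 1) = n) :
    ∃ c : k, component η A.X = c • A.link A j h := by
  refine Cone.exists_link_of_comp_ι hs _ h (c := 1 + n) rfl ?_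
  rw [(component_commutes η A.ι).eq rfl (by lia), h0, comp_zero, smul_zero]

/-- The component is a multiple of the link with exponent n + r, which is zero unless -r ≤ n < 0. In
that range q = n + r is less than r, and naturality along a morphism from the q-th to the r-th cone
allows induction on r. -/
lemma component_cone_eq_zero {n : ℤ} (hn : n ≠ 0) (η : gradedCenter k C n)
    (h0 : component η G = 0) (r : ℕ) : component η (K r).X = 0 := by
  induction r using Nat.strong_induction_on with
  | _ r ih =>
    obtain ⟨c, hc⟩ := exists_component_eq_link η h0 (by lia) (K r) (j := n + r) (by lia)
    by_cases hj : n + r < 0 ∨ 0 < n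
    · rw [hc, Cone.link_eq_zero _ _ (by lia) (by lia) (by lia), smul_zero]
    · obtain ⟨q, hq⟩ := Int.eq_ofNat_of_zero_le (a := n + r) (by lia)
      -- The morphism `e` lies over the two maps `ι`, so it carries the link of `K r` to the link
      -- from `K q` to `K r` with exponent q, which is nonzero.
      obtain ⟨e, he⟩ := (K r).exact₃.lift (K q).ι (n := 0) (by lia) rfl
        ((K q).ι_comp_z_eq_zero (by lia) (by lia) _)
      have h1 := (component_commutes η e).eq (c := n) (by lia) (by lia)
      rw [ih q (by lia), zero_comp, hc, comp_smul, mul_zero, Int.negOnePow_zero, one_smul,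
        Cone.link, assoc_l (n + r + 1) (by lia), assoc_l 1 rfl, ← he, eq_comm, smul_eq_zero] at h1
      rw [hc, h1.resolve_right ((K q).link_ne_zero (K r) (j := n + r) (by lia) (by lia) (by lia)
        (by lia)), zero_smul]

lemma exists_component_cone (η : gradedCenter k C 0) (h0 : component η G = 0) :
    ∃ c : ℕ → k, ∀ r, component η (K r).X = c r • (K r).socle := by
  choose c hc using fun r : ℕ =>
    exists_component_eq_link η h0 (s := (r : ℤ) + 1) (by lia) (K r) (j := r + 1 - 1) (by lia)
  exact ⟨c, hc⟩

end PolynomialGenerator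

end CategoryTheory.ShiftedHom

/-! ### Duality for cones and splitting of torsion -/

namespace CategoryTheory.ShiftedHom

open Pretriangulated gradedCenter

variable {k : Type*} [Field k] {C : Type*} [Category* C] [HasShift C ℤ] [Preadditive C]
  [Linear k C] [∀ n : ℤ, (shiftFunctor C n).Additive] [∀ n : ℤ, (shiftFunctor C n).Linear k]

variable (k) in
/-- Postcomposition with a shifted morphism. -/
noncomputable def postcomp (W : C) {X Y : C} {a n m : ℤ} (f : ShiftedHom X Y a) (h : a + n = m) :
    ShiftedHom W X n →ₗ[k] ShiftedHom W Y m where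
  toFun u := u.comp f h
  map_add' _ _ := add_comp _ _ _ _
  map_smul' _ _ := smul_comp _ _ _ _

@[simp]
lemma postcomp_apply (W : C) {X Y : C} {a n m : ℤ} (f : ShiftedHom X Y a) (h : a + n = m)
    (u : ShiftedHom W X n) : postcomp k W f h u = u.comp f h := rfl

lemma _root_.LinearMap.exists_comp_of_ker_le {V W U : Type*} [AddCommGroup V] [AddCommGroup W]
    [AddCommGroup U] [Module k V] [Module k W] [Module k U] (L : V →ₗ[k] W) (φ : V →ₗ[k] U)
    (h : ∀ v, L v = 0 → φ v = 0) : ∃ ψ : W →ₗ[k] U, ∀ v, φ v = ψ (L v) := by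
  obtain ⟨ψ, hψ⟩ := LinearMap.exists_extend
    ((LinearMap.ker L).liftQ φ h ∘ₗ L.quotKerEquivRange.symm.toLinearMap)
  refine ⟨ψ, fun v => ?_⟩
  have := LinearMap.congr_fun hψ ⟨L v, v, rfl⟩
  simp only [LinearMap.comp_apply, Submodule.subtype_apply] at this
  rw [this]
  have e : L.quotKerEquivRange.symm ⟨L v, v, rfl⟩ = Submodule.Quotient.mk v := by
    rw [LinearEquiv.symm_apply_eq]; rfl
  erw [e]
  rfl

variable [Limits.HasZeroObject C] [Pretriangulated C]

namespace PolynomialGenerator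

variable {G : C} (Γ : PolynomialGenerator k G)

section Duality

variable {Γ} {s : ℤ} (A : Γ.Cone s)

/-- The nondegeneracy of the pairing, given by a linear form `τ` on the endomorphisms of a
cone, between the morphisms to and from the cone. -/
structure Cone.IsPerfect (τ : ShiftedHom A.X A.X (0 : ℤ) →ₗ[k] k) (X : C) : Prop where
  inj : ∀ {n m : ℤ} (h : m + n = 0) (ρ : ShiftedHom X A.X m),
    (∀ g : ShiftedHom A.X X n, τ (g.comp ρ h) = 0) → ρ = 0
  surj : ∀ {n m : ℤ} (h : m + n = 0) (φ : ShiftedHom A.X X n →ₗ[k] k),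
    ∃ ρ : ShiftedHom X A.X m, ∀ g, φ g = τ (g.comp ρ h)

variable {A} {τ : ShiftedHom A.X A.X (0 : ℤ) →ₗ[k] k}

/-- For 1 ≤ n ≤ s the two spaces are spanned by ι z^(n-1) and z^(s-n) π, whose composite is the
socle. For other n both vanish. -/
lemma Cone.IsPerfect.generator (hs : 0 < s) (hτ : τ A.socle = 1) : A.IsPerfect τ G := by
  have key : ∀ {n m : ℤ} (h : m + n = 0) (h1 : n - 1 + 1 = n) (h2 : -s + (s - n) = m),
      1 ≤ n → n ≤ s → (A.ι.comp (Γ.z (n - 1)) h1).comp ((Γ.z (s - n)).comp A.π h2) h = A.socle := by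
    intro n m h h1 h2 hn hn'
    rw [assoc_r (m + (n - 1)) rfl, assoc_l (β := Γ.z (s - n)) (s - 1) (by lia),
      Γ.z_comp_z (a := n - 1) (b := s - n) (by lia) (by lia), socle, link,
      assoc_l (s - 1 + 1) (by lia)]
  constructor
  · intro n m h ρ hρ
    obtain ⟨c, rfl⟩ := A.exists_of_to hs.le ρ (j := s - n) (by lia)
    by_cases h0 : 1 ≤ n ∧ n ≤ s
    · have := hρ (A.ι.comp (Γ.z (n - 1)) (by lia))
      rw [comp_smul, key _ _ _ h0.1 h0.2, _root_.map_smul, hτ, smul_eq_mul, mul_one] at this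
      rw [this, zero_smul]
    · by_cases h1 : s - n < 0
      · rw [Γ.eq_zero h1 (Γ.z _)]; simp
      · rw [A.z_comp_π_eq_zero hs.le (by lia), smul_zero]
  · intro n m h φ
    by_cases h0 : 1 ≤ n ∧ n ≤ s
    · refine ⟨φ (A.ι.comp (Γ.z (n - 1)) (by lia)) • (Γ.z (s - n)).comp A.π (by lia), fun g => ?_⟩
      obtain ⟨c, rfl⟩ := A.exists_of_from hs.le g (j := n - 1) (by lia)
      rw [comp_smul, smul_comp, key _ _ _ h0.1 h0.2, _root_.map_smul, _root_.map_smul,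
        _root_.map_smul, hτ]
      simp [mul_comm]
    · refine ⟨0, fun g => ?_⟩
      obtain ⟨c, rfl⟩ := A.exists_of_from hs.le g (j := n - 1) (by lia)
      by_cases h1 : n - 1 < 0
      · rw [Γ.eq_zero h1 (Γ.z _)]; simp
      · rw [A.ι_comp_z_eq_zero hs.le (by lia)]; simp

lemma Cone.IsPerfect.of_gIso {X Y : C} {p q : ℤ} (i : GIso X Y p q) (hX : A.IsPerfect τ X) :
    A.IsPerfect τ Y := by
  have h0 := i.sum
  constructor
  · intro n m h ρ hρ
    have := hX.inj (n := n + q) (m := m + p) (by lia) (i.hom.comp ρ rfl) (fun g => by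
      rw [assoc_l n (by lia)]
      exact hρ _)
    have := congrArg (fun x => i.inv.comp x (c := m) (by lia)) this
    simpa only [i.inv_hom_comp, comp_zero] using this
  · intro n m h φ
    obtain ⟨ρ, hρ⟩ := hX.surj (n := n + q) (m := m + p) (by lia)
      (φ ∘ₗ postcomp k A.X i.hom (by lia))
    refine ⟨i.inv.comp ρ (by lia), fun g => ?_⟩
    have := hρ (g.comp i.inv (by lia))
    simp only [LinearMap.comp_apply, postcomp_apply, i.comp_inv_hom] at this
    rw [this, assoc_l (n + q) (by lia)]

/-- A five-lemma argument comparing Hom(-, A) with the dual of Hom(A, -); with `of_gIso` and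
`generator` it propagates the duality to every object. -/
lemma Cone.IsPerfect.of_isExactAt {X Y Z : C} {f : ShiftedHom X Y (0 : ℤ)}
    {g : ShiftedHom Y Z (0 : ℤ)} {h : ShiftedHom Z X (1 : ℤ)} (h1 : IsExactAt f g)
    (h2 : IsExactAt g h) (h3 : IsExactAt h f) (hX : A.IsPerfect τ X) (hZ : A.IsPerfect τ Z) :
    A.IsPerfect τ Y := by
  constructor
  · intro n m e ρ hρ
    obtain ⟨σ, rfl⟩ := h1.desc ρ (add_zero m) (add_zero m) (hX.inj e _ (fun u => by
      rw [assoc_l n (zero_add n)]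
      exact hρ _))
    -- The functional defined by `σ` kills everything coming from `Y`, so it factors through `h` and
    -- is represented on `X` by `σ'`. Duality for `Z` then gives that `σ` is `h` followed by `σ'`,
    -- which `g` kills.
    obtain ⟨ψ, hψ⟩ := LinearMap.exists_comp_of_ker_le (postcomp k A.X h (n := n) rfl)
      (τ ∘ₗ postcomp k A.X σ e) (fun v hv => by
        obtain ⟨v', rfl⟩ := h2.lift v (zero_add n) rfl hv
        have := hρ v'
        rwa [assoc_l n (zero_add n)] at this)
    obtain ⟨σ', hσ'⟩ := hX.surj (n := 1 + n) (m := m - 1) (by lia) ψ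
    have h4 : σ - h.comp σ' (c := m) (by lia) = 0 := hZ.inj e _ (fun v => by
      have := hψ v
      rw [hσ'] at this
      simp only [LinearMap.comp_apply, postcomp_apply] at this
      rw [sub_eq_add_neg, comp_add, comp_neg, _root_.map_add, _root_.map_neg, this,
        assoc_l (1 + n) rfl, add_neg_cancel])
    rw [sub_eq_zero.1 h4, assoc_l 1 (by lia), h2.zero, zero_comp]
  · intro n m e φ
    obtain ⟨ρ, hρ⟩ := hX.surj e (φ ∘ₗ postcomp k A.X f (zero_add n))
    have h4 : h.comp ρ (c := m + 1) rfl = 0 := by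
      refine hZ.inj (n := n - 1) (by lia) _ (fun v => ?_)
      rw [assoc_l n (by lia), ← hρ, LinearMap.comp_apply, postcomp_apply, assoc_r 1 (by lia),
        h3.zero, comp_zero, _root_.map_zero]
    obtain ⟨ρ', rfl⟩ := h3.desc ρ (add_zero m) _ h4
    obtain ⟨ψ, hψ⟩ := LinearMap.exists_comp_of_ker_le (postcomp k A.X g (zero_add n))
      (φ - τ ∘ₗ postcomp k A.X ρ' e) (fun v hv => by
        obtain ⟨v', rfl⟩ := h1.lift v (zero_add n) (zero_add n) hv
        have := hρ v'
        simp only [LinearMap.comp_apply, postcomp_apply] at this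
        rw [LinearMap.sub_apply, LinearMap.comp_apply, postcomp_apply, this,
          assoc_r m (add_zero m), sub_self])
    obtain ⟨σ, hσ⟩ := hZ.surj e ψ
    refine ⟨ρ' + g.comp σ (add_zero m), fun v => ?_⟩
    have := hψ v
    rw [hσ] at this
    simp only [LinearMap.sub_apply, LinearMap.comp_apply, postcomp_apply] at this
    rw [comp_add, _root_.map_add, assoc_l n (zero_add n), ← this]
    abel

lemma Cone.isPerfect (hs : 0 < s) (hτ : τ A.socle = 1) (X : C) : A.IsPerfect τ X :=
  Γ.generates (A.IsPerfect τ) (.generator hs hτ) (fun i => .of_gIso i)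
    (fun _ _ _ hT => .of_isExactAt (isExactAt_of_distTriang hT) (isExactAt_of_distTriang₂ hT)
      (isExactAt_of_distTriang₃ hT)) X

lemma Cone.exists_eq_smul_add (hs : 0 < s) (A : Γ.Cone s) (f : ShiftedHom A.X A.X (0 : ℤ)) :
    ∃ a b : k, f = a • gid A.X + b • A.socle := by
  obtain ⟨a, ha⟩ := A.exists_of_from hs.le (f.comp A.ι (c := 1) rfl) (j := 0) (by lia)
  rw [Γ.z_zero, comp_gid] at ha
  obtain ⟨b, hb⟩ := Cone.exists_link_of_comp_ι (A := A) (B := A) hs.le (f - a • gid A.X)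
    (j := s - 1) (c := 1) (by lia) (by lia) (by
      rw [sub_eq_add_neg, add_comp, neg_comp, ha, smul_comp, gid_comp, add_neg_cancel])
  exact ⟨a, b, by rw [socle, ← hb]; abel⟩

/-- A morphism from a cone which does not vanish on the socle is a split monomorphism. -/
lemma Cone.exists_retraction (hs : 0 < s) (A : Γ.Cone s) {X : C} {n m : ℤ}
    (f : ShiftedHom A.X X n) (hf : A.socle.comp f (add_zero n) ≠ 0) (h : m + n = 0) :
    ∃ ρ : ShiftedHom X A.X m, f.comp ρ h = gid A.X := by
  obtain ⟨τ, hτ⟩ := Module.Projective.exists_dual_eq_one k (A.socle_ne_zero hs)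
  obtain ⟨φ, hφ⟩ := Module.Projective.exists_dual_eq_one k hf
  -- As `φ` is 1 on the socle followed by `f`, the identity coefficient of `f.comp ρ h` is 1. This
  -- unit 1 + b·socle is inverted by 1 - b·socle, because the socle has square zero.
  obtain ⟨ρ, hρ⟩ := (A.isPerfect hs hτ X).surj h φ
  have h1 := hρ (A.socle.comp f (add_zero n))
  obtain ⟨a, b, hab⟩ := A.exists_eq_smul_add hs (f.comp ρ h)
  rw [hφ, assoc_r 0 h, hab, comp_add, comp_smul, comp_smul, A.socle_comp_socle, comp_gid,
    smul_zero, add_zero, _root_.map_smul, hτ, smul_eq_mul, mul_one] at h1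
  subst h1
  refine ⟨ρ.comp (gid A.X - b • A.socle) (zero_add m), ?_⟩
  rw [assoc_l 0 h, hab, sub_eq_add_neg, comp_add, comp_neg, comp_smul, comp_gid, add_comp,
    smul_comp, smul_comp, gid_comp, socle_comp_socle, one_smul, smul_zero, add_zero,
    one_smul, add_neg_cancel_right]

end Duality

/-! ### Finiteness of Hom*(G, X) over k[z] -/

section Finiteness

/-- Finiteness of the graded module of shifted morphisms from the generator. -/
structure IsFiniteFrom (X : C) (a N : ℤ) : Prop where
  finite : ∀ n : ℤ, Module.Finite k (ShiftedHom G X n)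
  eq_zero : ∀ {n : ℤ}, n < a → ∀ u : ShiftedHom G X n, u = 0
  inj : ∀ {n m : ℤ} (_ : N ≤ n) (h : n + 1 = m) (u : ShiftedHom G X n),
    (Γ.z 1).comp u h = 0 → u = 0
  surj : ∀ {n m : ℤ} (_ : N ≤ n) (h : n + 1 = m) (u : ShiftedHom G X m),
    ∃ v : ShiftedHom G X n, u = (Γ.z 1).comp v h

variable {Γ}

lemma IsFiniteFrom.generator : Γ.IsFiniteFrom G 0 0 where
  finite n := by
    have : Submodule.span k {Γ.z n} = ⊤ := by
      rw [eq_top_iff]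
      rintro f -
      obtain ⟨c, rfl⟩ := Γ.exists_smul f
      exact Submodule.smul_mem _ _ (Submodule.mem_span_singleton_self _)
    exact ⟨⟨{Γ.z n}, by simpa using this⟩⟩
  eq_zero h u := Γ.eq_zero h u
  inj {n m} hn h u hu := by
    obtain ⟨c, rfl⟩ := Γ.exists_smul u
    rw [comp_smul, Γ.z_comp_z (by lia) hn, smul_eq_zero] at hu
    rw [hu.resolve_right (Γ.z_ne_zero (by lia)), zero_smul]
  surj {n m} hn h u := by
    obtain ⟨c, rfl⟩ := Γ.exists_smul u
    exact ⟨c • Γ.z n, by rw [comp_smul, Γ.z_comp_z (by lia) hn]⟩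

lemma IsFiniteFrom.mono {X : C} {a N a' N' : ℤ} (hX : Γ.IsFiniteFrom X a N) (ha : a' ≤ a)
    (hN : N ≤ N') : Γ.IsFiniteFrom X a' N' where
  finite := hX.finite
  eq_zero h := hX.eq_zero (by lia)
  inj h := hX.inj (by lia)
  surj h := hX.surj (by lia)

lemma IsFiniteFrom.of_gIso {X Y : C} {p q a N : ℤ} (i : GIso X Y p q)
    (hX : Γ.IsFiniteFrom X a N) : Γ.IsFiniteFrom Y (a + p) (N + p) := by
  have h0 := i.sum
  constructor
  · intro n
    have := hX.finite (n + q)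
    exact Module.Finite.of_surjective (postcomp k G i.hom (n := n + q) (m := n) (by lia))
      fun u => ⟨u.comp i.inv (by lia), i.comp_inv_hom u _ _⟩
  · intro n hn u
    have := hX.eq_zero (n := n + q) (by lia) (u.comp i.inv (by lia))
    rw [← i.comp_inv_hom u (b := n + q) (by lia) (by lia), this, zero_comp]
  · intro n m hn h u hu
    have := hX.inj (n := n + q) (m := m + q) (by lia) (by lia) (u.comp i.inv (by lia)) (by
      rw [assoc_l m h, hu, zero_comp])
    rw [← i.comp_inv_hom u (b := n + q) (by lia) (by lia), this, zero_comp]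
  · intro n m hn h u
    obtain ⟨v, hv⟩ := hX.surj (n := n + q) (m := m + q) (by lia) (by lia) (u.comp i.inv (by lia))
    refine ⟨v.comp i.hom (by lia), ?_⟩
    rw [assoc_l (m + q) (by lia), ← hv, i.comp_inv_hom]

/-- Multiplication by z is compared along the long exact sequence. The bound becomes N + 1 because
`h` has degree 1: injectivity in degree n uses surjectivity for `Z` out of degree n - 1. -/
lemma IsFiniteFrom.of_isExactAt {X Y Z : C} {f : ShiftedHom X Y (0 : ℤ)}
    {g : ShiftedHom Y Z (0 : ℤ)} {h : ShiftedHom Z X (1 : ℤ)} (h1 : IsExactAt f g)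
    (h2 : IsExactAt g h) (h3 : IsExactAt h f) {a N : ℤ} (hX : Γ.IsFiniteFrom X a N)
    (hZ : Γ.IsFiniteFrom Z a N) : Γ.IsFiniteFrom Y a (N + 1) := by
  constructor
  · intro n
    have := hX.finite n
    have := hZ.finite n
    refine ⟨Submodule.fg_of_fg_map_of_fg_inf_ker (postcomp k G g (zero_add n))
      (IsNoetherian.noetherian _) ?_⟩
    have : LinearMap.ker (postcomp k G g (zero_add n)) ≤
        LinearMap.range (postcomp k G f (zero_add n)) := fun u hu =>
      (h1.lift u (zero_add n) (zero_add n) hu).imp fun v hv => hv.symm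
    have := Submodule.finiteDimensional_of_le this
    rw [top_inf_eq]
    exact Submodule.FG.of_finite
  · intro n hn u
    obtain ⟨v, rfl⟩ := h1.lift u (zero_add n) (zero_add n) (hZ.eq_zero hn _)
    rw [hX.eq_zero hn v, zero_comp]
  · intro n m hn e u hu
    obtain ⟨v, rfl⟩ := h1.lift u (zero_add n) (zero_add n) (hZ.inj (m := m) (by lia) e _ (by
      rw [assoc_l m e, hu, zero_comp]))
    rw [assoc_l m e] at hu
    obtain ⟨t, ht⟩ := h3.lift _ (n := n) (by lia) _ hu
    obtain ⟨t, rfl⟩ := hZ.surj (n := n - 1) (by lia) (by lia) t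
    have := hX.inj (m := m) (by lia) e (v - t.comp h (by lia)) (by
      rw [sub_eq_add_neg, comp_add, comp_neg, ht, assoc_r n (by lia), add_neg_cancel])
    rw [sub_eq_zero.1 this, assoc_r 1 (by lia), h3.zero, comp_zero]
  · intro n m hn e u
    obtain ⟨t, ht⟩ := hZ.surj (by lia) e (u.comp g (zero_add m))
    obtain ⟨y, rfl⟩ := h2.lift t (zero_add n) (c := m) (by lia)
      (hX.inj (m := m + 1) (by lia) rfl _ (by
        rw [assoc_l m e, ← ht, assoc_r 1 (by lia), h2.zero, comp_zero]))
    obtain ⟨x, hx⟩ := h1.lift (u - (Γ.z 1).comp y e) (zero_add m) (zero_add m) (by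
      rw [sub_eq_add_neg, add_comp, neg_comp, ht, assoc_r n (zero_add n), add_neg_cancel])
    obtain ⟨x, rfl⟩ := hX.surj (by lia) e x
    refine ⟨y + x.comp f (zero_add n), ?_⟩
    rw [comp_add, assoc_l m e, ← hx]
    abel

variable (Γ) in
lemma exists_isFiniteFrom (X : C) : ∃ a N : ℤ, Γ.IsFiniteFrom X a N := by
  refine Γ.generates (fun X => ∃ a N : ℤ, Γ.IsFiniteFrom X a N) ⟨0, 0, .generator⟩
    (fun i ⟨a, N, h⟩ => ⟨_, _, h.of_gIso i⟩) ?_ X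
  rintro X Y Z f g h hT ⟨a, N, hX⟩ ⟨b, M, hZ⟩
  exact ⟨_, _, .of_isExactAt (isExactAt_of_distTriang hT) (isExactAt_of_distTriang₂ hT)
    (isExactAt_of_distTriang₃ hT) (hX.mono (min_le_left a b) (le_max_left N M))
    (hZ.mono (min_le_right a b) (le_max_right N M))⟩

include Γ in
/-- Objects are detected by the shifted morphisms from the generator. -/
lemma eq_zero_of_forall {X : C} (hX : ∀ (n : ℤ) (u : ShiftedHom G X n), u = 0) {Y : C} {n : ℤ}
    (f : ShiftedHom Y X n) : f = 0 := by
  revert n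
  refine Γ.generates (fun Y => ∀ {n : ℤ} (f : ShiftedHom Y X n), f = 0) (hX _) ?_ ?_ Y
  · intro Y Z p q i h n f
    have := i.sum
    rw [← i.inv_hom_comp f (b := n + p) rfl (by lia), h (i.hom.comp f _), comp_zero]
  · intro Y Y' Y'' f g h hT h1 h2 n u
    obtain ⟨v, rfl⟩ := (isExactAt_of_distTriang hT).desc u (add_zero n) (add_zero n) (h1 _)
    rw [h2 v, comp_zero]

end Finiteness

end PolynomialGenerator

end CategoryTheory.ShiftedHom

/-! ### Decomposition of objects into shifts of the generator and of cones -/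

namespace CategoryTheory.ShiftedHom

open Pretriangulated gradedCenter

section

variable {C : Type*} [Category* C] [HasShift C ℤ] [Preadditive C]
  [∀ n : ℤ, (shiftFunctor C n).Additive]

lemma FactorsThrough.trans {I J : Type*} {S : I → C} {T : J → C} {X Y : C} {n : ℤ}
    {f : ShiftedHom X Y n} (hf : FactorsThrough S f) (hT : ∀ i, FactorsThrough T (gid (S i))) :
    FactorsThrough T f := by
  induction hf with
  | zero => exact .zero
  | add _ _ h1 h2 => exact h1.add h2
  | comp i f g h => exact ((hT i).of_gid_right f).comp_right g h

lemma FactorsThrough.of_index {I : Type*} (S : I → C) (i : I) : FactorsThrough S (gid (S i)) := by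
  have := FactorsThrough.comp (S := S) i (gid (S i)) (gid (S i)) (add_zero 0)
  rwa [gid_comp] at this

/-- If the cone of a morphism splits off, the identity is a sum of a morphism through the source
and a morphism through the cone. -/
lemma FactorsThrough.of_split {I : Type*} {S : I → C} {X Y Z : C} {a b c : ℤ}
    {f : ShiftedHom X Y a} {q : ShiftedHom Y Z b} (h : IsExactAt f q) (s : ShiftedHom Z Y c)
    (hbc : b + c = 0) (hs : s.comp q hbc = gid Z) (hX : FactorsThrough S (gid X))
    (hZ : FactorsThrough S (gid Z)) : FactorsThrough S (gid Y) := by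
  obtain ⟨v, hv⟩ := h.lift (gid Y - q.comp s (by lia)) (n := -a) (by lia) (c := b) (by lia) (by
    rw [sub_eq_add_neg, add_comp, neg_comp, gid_comp, assoc_r 0 hbc, hs, comp_gid,
      add_neg_cancel])
  rw [← sub_add_cancel (gid Y) (q.comp s (by lia)), hv]
  exact ((hX.of_gid_right v).comp_right f _).add ((hZ.of_gid_right q).comp_right s _)

lemma FactorsThrough.of_split' {I : Type*} {S : I → C} {X Y Z : C} {a b c : ℤ}
    {f : ShiftedHom X Y a} {q : ShiftedHom Y Z b} (h : IsExactAt f q) (r : ShiftedHom Y X c)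
    (hac : c + a = 0) (hr : f.comp r hac = gid X) (hX : FactorsThrough S (gid X))
    (hZ : FactorsThrough S (gid Z)) : FactorsThrough S (gid Y) := by
  obtain ⟨v, hv⟩ := h.desc (gid Y - r.comp f (by lia)) (n := -b) (by lia) (c := a) (by lia) (by
    rw [sub_eq_add_neg, comp_add, comp_neg, comp_gid, assoc_l 0 hac, hr, gid_comp,
      add_neg_cancel])
  rw [← sub_add_cancel (gid Y) (r.comp f (by lia)), hv]
  exact ((hZ.of_gid_right q).comp_right v _).add ((hX.of_gid_right r).comp_right f _)

lemma exists_cone_degree_zero [Limits.HasZeroObject C] [Pretriangulated C] {X Y : C} {n m : ℤ}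
    (f : ShiftedHom X Y n) (h : n + m = 1) :
    ∃ (Z : C) (q : ShiftedHom Y Z (0 : ℤ)) (δ : ShiftedHom Z X m),
      IsExactAt f q ∧ IsExactAt q δ ∧ IsExactAt δ f := by
  obtain ⟨Z, q, δ, h1, h2, h3, -⟩ := exists_cone f
  let i := (shiftGIso Z (-n)).symm
  exact ⟨_, q.comp i.hom (by lia), i.inv.comp δ (by lia), h1.comp_iso i _, h2.conj_iso i _ _,
    h3.iso_comp i.symm _⟩

end

variable {k : Type*} [Field k] {C : Type*} [Category* C] [HasShift C ℤ] [Preadditive C]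
  [Linear k C] [∀ n : ℤ, (shiftFunctor C n).Additive] [∀ n : ℤ, (shiftFunctor C n).Linear k]
  [Limits.HasZeroObject C] [Pretriangulated C]

namespace PolynomialGenerator

variable {G : C} (Γ : PolynomialGenerator k G)

/-- Finite generation, in bounded degrees, of the graded module of shifted morphisms from the
generator. -/
structure IsGeneratedFrom (X : C) (a N : ℤ) : Prop where
  finite : ∀ n : ℤ, Module.Finite k (ShiftedHom G X n)
  eq_zero : ∀ {n : ℤ}, n < a → ∀ u : ShiftedHom G X n, u = 0
  surj : ∀ {n m : ℤ} (_ : N ≤ n) (h : n + 1 = m) (u : ShiftedHom G X m),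
    ∃ v : ShiftedHom G X n, u = (Γ.z 1).comp v h

variable {Γ}

/-- Eventual injectivity of z is dropped because it need not pass to quotients of Hom*(G, X), and
the inductions below replace `X` by an object with such a quotient. -/
lemma IsFiniteFrom.isGeneratedFrom {X : C} {a N : ℤ} (hX : Γ.IsFiniteFrom X a N) :
    Γ.IsGeneratedFrom X a N := ⟨hX.finite, hX.eq_zero, hX.surj⟩

lemma z_comp_of_eq_zero {X : C} {j n : ℤ} (hj : j = 0) (u : ShiftedHom G X n) (h : n + j = n) :
    (Γ.z j).comp u h = u := by
  subst hj
  rw [Γ.z_zero, gid_comp]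

lemma z_comp_congr {X : C} {i j n m : ℤ} (hij : i = j) (u : ShiftedHom G X n) (h : n + i = m) :
    (Γ.z i).comp u h = (Γ.z j).comp u (by lia) := by
  subst hij
  rfl

namespace IsGeneratedFrom

variable {X Y : C} {a N : ℤ}

lemma of_surjective (hX : Γ.IsGeneratedFrom X a N) (q : ShiftedHom X Y (0 : ℤ))
    (hq : ∀ {n : ℤ} (u : ShiftedHom G Y n), ∃ v : ShiftedHom G X n, v.comp q (zero_add n) = u) :
    Γ.IsGeneratedFrom Y a N where
  finite n := have := hX.finite n
    Module.Finite.of_surjective (postcomp k G q (zero_add n)) hq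
  eq_zero {n} hn u := by
    obtain ⟨v, rfl⟩ := hq u
    rw [hX.eq_zero hn v, zero_comp]
  surj {n m} hn h u := by
    obtain ⟨v, rfl⟩ := hq u
    obtain ⟨v, rfl⟩ := hX.surj hn h v
    exact ⟨v.comp q (zero_add n), by rw [assoc_r n (zero_add n)]⟩

/-- The termination measure: the total dimension in degrees `a` to `N` drops when a surjection kills
something nonzero there. -/
lemma sum_finrank_lt (hX : Γ.IsGeneratedFrom X a N) (q : ShiftedHom X Y (0 : ℤ))
    (hq : ∀ {n : ℤ} (u : ShiftedHom G Y n), ∃ v : ShiftedHom G X n, v.comp q (zero_add n) = u)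
    {n : ℤ} (hn : n ≤ N) (u : ShiftedHom G X n) (hu : u ≠ 0) (huq : u.comp q (zero_add n) = 0) :
    ∑ i ∈ Finset.Icc a N, Module.finrank k (ShiftedHom G Y i) <
      ∑ i ∈ Finset.Icc a N, Module.finrank k (ShiftedHom G X i) := by
  have hf := hX.finite
  have hr (i : ℤ) : LinearMap.range (postcomp k G q (zero_add i)) = ⊤ :=
    LinearMap.range_eq_top.2 hq
  have key (i : ℤ) : Module.finrank k (ShiftedHom G Y i) +
      Module.finrank k (LinearMap.ker (postcomp k G q (zero_add i))) =
        Module.finrank k (ShiftedHom G X i) := by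
    rw [← LinearMap.finrank_range_add_finrank_ker (postcomp k G q (zero_add i)), hr, finrank_top]
  refine Finset.sum_lt_sum (fun i _ => ?_) ⟨n, Finset.mem_Icc.2 ⟨?_, hn⟩, ?_⟩
  · rw [← key i]; exact Nat.le_add_right _ _
  · by_contra! h
    exact hu (hX.eq_zero h u)
  · rw [← key n]
    have : LinearMap.ker (postcomp k G q (zero_add n)) ≠ ⊥ := fun h0 =>
      hu ((Submodule.mem_bot k).1 (h0 ▸ huq))
    exact Nat.lt_add_of_pos_right
      (Module.finrank_pos_iff.2 (Submodule.nontrivial_iff_ne_bot.2 this))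

/-- A nonzero morphism is divisible by a largest power of `z`. -/
lemma exists_eq_z_comp (hX : Γ.IsGeneratedFrom X a N) {n : ℤ} (w : ShiftedHom G X n)
    (hw : w ≠ 0) : ∃ (r : ℕ) (m : ℤ) (h : m + r = n) (u : ShiftedHom G X m), m ≤ N ∧
      w = (Γ.z r).comp u h ∧
      (∀ (p : ℤ) (h' : p + (r + 1) = n) (v : ShiftedHom G X p), w ≠ (Γ.z (r + 1)).comp v h') ∧
      ∀ (p : ℤ) (h' : p + 1 = m) (v : ShiftedHom G X p), u ≠ (Γ.z 1).comp v h' := by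
  classical
  let P (r : ℕ) : Prop := ∃ (m : ℤ) (h : m + r = n) (u : ShiftedHom G X m), w = (Γ.z r).comp u h
  have h0 : P 0 := ⟨n, by lia, w, (z_comp_of_eq_zero (by lia) _ _).symm⟩
  have hP {r : ℕ} (hr : P r) : r ≤ (n - a).toNat := by
    obtain ⟨m, h, u, rfl⟩ := hr
    by_contra! hr
    exact hw (by rw [hX.eq_zero (by lia) u, comp_zero])
  obtain ⟨r, ⟨m, h, u, hu⟩, hmax⟩ : ∃ r, P r ∧ ¬ P (r + 1) :=
    ⟨_, Nat.findGreatest_spec (Nat.zero_le (n - a).toNat) h0, fun h1 =>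
      Nat.findGreatest_is_greatest (Nat.lt_succ_self _) (hP h1) h1⟩
  have hr (p : ℤ) (h' : p + (r + 1) = n) (v : ShiftedHom G X p) : w ≠ (Γ.z (r + 1)).comp v h' := by
    intro hv
    exact hmax ⟨p, by push_cast; exact h', v, hv⟩
  have hr' (p : ℤ) (h' : p + 1 = m) (v : ShiftedHom G X p) : u ≠ (Γ.z 1).comp v h' := by
    rintro rfl
    refine hr p (by lia) v ?_
    rw [hu, assoc_l (r + 1) (by lia), Γ.z_comp_z (by lia) (by lia)]
  refine ⟨r, m, h, u, ?_, hu, hr, hr'⟩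
  by_contra! hm
  obtain ⟨v, hv⟩ := hX.surj (n := m - 1) (by lia) (by lia) u
  exact hr' _ _ _ hv

end IsGeneratedFrom

/-- Torsion-free finitely generated k[z]-modules are free. An element `u` not divisible by z
generates a free submodule with torsion-free quotient; the cone of `u` realizes the quotient, and
the sequence splits. -/
lemma factorsThrough_generator {a N : ℤ} {X : C} (hX : Γ.IsGeneratedFrom X a N)
    (hz : ∀ {n m : ℤ} (h : n + 1 = m) (u : ShiftedHom G X n), (Γ.z 1).comp u h = 0 → u = 0) :
    FactorsThrough (fun _ : Unit => G) (gid X) := by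
  induction hd : ∑ i ∈ Finset.Icc a N, Module.finrank k (ShiftedHom G X i) using
    Nat.strong_induction_on generalizing X with
  | _ d ih =>
  by_cases h0 : ∀ (n : ℤ) (u : ShiftedHom G X n), u = 0
  · rw [Γ.eq_zero_of_forall h0 (gid X)]
    exact .zero
  push Not at h0
  obtain ⟨n, w, hw⟩ := h0
  obtain ⟨-, n, -, u, hn, -, -, hu⟩ := hX.exists_eq_z_comp w hw
  have hzr : ∀ (j : ℤ), 0 ≤ j → ∀ {n m : ℤ} (h : n + j = m) (u : ShiftedHom G X n),
      (Γ.z j).comp u h = 0 → u = 0 := by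
    intro j hj
    obtain ⟨j, rfl⟩ := Int.eq_ofNat_of_zero_le hj
    clear hj
    induction j with
    | zero =>
      intro n m h u hu
      obtain rfl : n = m := by lia
      rwa [z_comp_of_eq_zero (by lia)] at hu
    | succ j ih =>
      intro n m h u hu
      rw [← Γ.z_comp_z (a := 1) (b := j) (by lia) (by lia) (by lia), assoc_r (n + j) rfl] at hu
      exact ih rfl u (hz _ _ hu)
  have hu0 : u ≠ 0 := fun h => hu (n - 1) (by lia) 0 (by rw [h, comp_zero])
  obtain ⟨Y, q, δ, h1, h2, h3⟩ := exists_cone_degree_zero u (m := 1 - n) (by lia)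
  have hδ : ∀ {m c : ℤ} (v : ShiftedHom G Y m) (h : 1 - n + m = c), v.comp δ h = 0 := by
    intro m c v h
    have h4 : (v.comp δ h).comp u (c := m + 1) (by lia) = 0 := by
      rw [assoc_r 1 (by lia), h3.zero, comp_zero]
    obtain hc | hc := lt_or_ge c 0
    · exact Γ.eq_zero hc _
    obtain ⟨b, hb⟩ := Γ.exists_smul (v.comp δ h)
    rw [hb, smul_comp, smul_eq_zero] at h4
    obtain h4 | h4 := h4
    · rw [hb, h4, zero_smul]
    · exact absurd (hzr c hc _ u h4) hu0
  have hq : ∀ {m : ℤ} (v : ShiftedHom G Y m), ∃ v' : ShiftedHom G X m,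
      v'.comp q (zero_add m) = v := by
    intro m v
    obtain ⟨v', rfl⟩ := h2.lift v (zero_add m) rfl (hδ v _)
    exact ⟨v', rfl⟩
  have hY := ih _ (hd ▸ hX.sum_finrank_lt q hq hn u hu0 (h1.zero _)) (hX.of_surjective q hq) (by
    intro p m h v hv
    obtain ⟨v, rfl⟩ := hq v
    rw [assoc_l m h] at hv
    obtain ⟨t, ht⟩ := h1.lift _ (n := m - n) (by lia) _ hv
    obtain ⟨b, rfl⟩ := Γ.exists_smul t
    rw [smul_comp] at ht
    obtain hc | hc | hc := lt_trichotomy (m - n) 0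
    · rw [Γ.eq_zero hc (Γ.z _), zero_comp, smul_zero] at ht
      rw [hz _ _ ht, zero_comp]
    · obtain rfl : m = n := by lia
      by_cases hb : b = 0
      · rw [hb, zero_smul] at ht
        rw [hz _ _ ht, zero_comp]
      · refine absurd ?_ (hu p h (b⁻¹ • v))
        rw [comp_smul, ht, smul_smul, inv_mul_cancel₀ hb, one_smul]
        rw [z_comp_of_eq_zero (by lia)]
    · have h5 : (Γ.z 1).comp (v - b • (Γ.z (m - n - 1)).comp u (by lia)) h = 0 := by
        rw [sub_eq_add_neg, comp_add, comp_neg, ht, comp_smul, assoc_l (m - n) (by lia),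
          Γ.z_comp_z (by lia) (by lia), add_neg_cancel]
      rw [sub_eq_zero.1 (hz _ _ h5), smul_comp, assoc_r n (by lia), h1.zero, comp_zero,
        smul_zero]) rfl
  -- By induction `Y` is built from `G` by retracts of sums, so vanishing of `δ` on morphisms from
  -- `G` suffices.
  have hδ0 : δ = 0 := hY.eq_of_gid (fun i a c u h => by rw [hδ, comp_zero])
  obtain ⟨s, hs⟩ := h2.lift (gid Y) (zero_add 0) rfl (by rw [hδ0, comp_zero])
  exact .of_split h1 s _ hs.symm (.of_index (fun _ : Unit => G) ()) hY

/-- The generator and the cones of the powers of `z` generate all objects as direct summands of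
finite sums of shifts. -/
theorem factorsThrough_objs (K : ∀ r : ℕ, Γ.Cone (r + 1)) (X : C) :
    FactorsThrough (objs K) (gid X) := by
  obtain ⟨a, N, hX⟩ := Γ.exists_isFiniteFrom X
  replace hX := hX.isGeneratedFrom
  induction hd : ∑ i ∈ Finset.Icc a N, Module.finrank k (ShiftedHom G X i) using
    Nat.strong_induction_on generalizing X with
  | _ d ih =>
  by_cases hz : ∀ {n m : ℤ} (h : n + 1 = m) (u : ShiftedHom G X n), (Γ.z 1).comp u h = 0 → u = 0
  · exact (factorsThrough_generator hX hz).trans fun _ => .of_index (objs K) none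
  push Not at hz
  obtain ⟨n, m, h, w, hw, hw0⟩ := hz
  -- Write the torsion element as z^r u with r maximal. Then z^(r+1) u = 0, so `u` extends along `π`
  -- to a morphism `f` out of `K r`.
  obtain ⟨r, p, hp, u, hpN, rfl, hu, -⟩ := hX.exists_eq_z_comp w hw0
  have hu0 : u ≠ 0 := fun h => hw0 (by rw [h, comp_zero])
  rw [assoc_l (r + 1) rfl, Γ.z_comp_z (by lia) (by lia) (c := r + 1) (by lia)] at hw
  obtain ⟨f, rfl⟩ := (K r).exact₁.desc u (n := p + (r + 1)) (by lia) _ hw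
  -- The socle followed by `f` is `ι` followed by z^r u; its vanishing would make z^r u divisible by
  -- z^(r+1).
  have hf : (K r).socle.comp f (add_zero _) ≠ 0 := by
    intro h0
    rw [Cone.socle, Cone.link, assoc_r p (by lia), assoc_r n (by lia)] at h0
    obtain ⟨v, hv⟩ := (K r).exact₃.desc _ (n := n - (r + 1)) (by lia) _ h0
    refine hu (n - (r + 1)) (by lia) v ?_
    rw [← hv, z_comp_congr (i := r) (j := r + 1 - 1) (by lia)]
  obtain ⟨ρ, hρ⟩ := (K r).exists_retraction (by lia) f hf (m := -(p + (r + 1))) (by lia)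
  obtain ⟨Y, q, δ, h1, h2, h3⟩ := exists_cone_degree_zero f (m := 1 - (p + (r + 1))) (by lia)
  have hδ : δ = 0 := by
    rw [← comp_gid δ (zero_add _), ← hρ, assoc_l 1 (by lia), h3.zero, zero_comp]
  have hq : ∀ {m : ℤ} (v : ShiftedHom G Y m), ∃ v' : ShiftedHom G X m,
      v'.comp q (zero_add m) = v := by
    intro m v
    obtain ⟨v', rfl⟩ := h2.lift v (zero_add m) rfl (by rw [hδ, comp_zero])
    exact ⟨v', rfl⟩
  exact .of_split' h1 ρ _ hρ (.of_index (objs K) (some r)) (ih _ (hd ▸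
    hX.sum_finrank_lt q hq hpN _ hu0 (by rw [assoc_r _ rfl, h1.zero, comp_zero])) Y
    (hX.of_surjective q hq) rfl)

end PolynomialGenerator

end CategoryTheory.ShiftedHom

/-! ### Socle elements and the degree zero part -/

namespace CategoryTheory.ShiftedHom

open Pretriangulated gradedCenter

variable {k : Type*} [Field k] {C : Type*} [Category* C] [HasShift C ℤ] [Preadditive C]
  [Linear k C] [∀ n : ℤ, (shiftFunctor C n).Additive] [∀ n : ℤ, (shiftFunctor C n).Linear k]

lemma component_mul {a b c : ℤ} (η : gradedCenter k C a) (ζ : gradedCenter k C b) (h : a + b = c)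
    (X : C) : component (gradedCenter.mul η ζ h) X =
      (component η X).comp (component ζ X) ((add_comm b a).trans h) :=
  mul_app η ζ h X

lemma component_one (X : C) : component (gradedCenter.one k C) X = gid X := one_app X

variable (k) in
/-- The component at an object, as a linear map. -/
def componentₗ (n : ℤ) (X : C) : gradedCenter k C n →ₗ[k] ShiftedHom X X n where
  toFun η := component η X
  map_add' _ _ := rfl
  map_smul' _ _ := rfl

lemma component_add {n : ℤ} (η ζ : gradedCenter k C n) (X : C) :
    component (η + ζ) X = component η X + component ζ X := rfl

lemma component_smul {n : ℤ} (c : k) (η : gradedCenter k C n) (X : C) :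
    component (c • η) X = c • component η X := rfl

lemma component_zero {n : ℤ} (X : C) : component (0 : gradedCenter k C n) X = 0 := rfl

variable [Limits.HasZeroObject C] [Pretriangulated C]

namespace PolynomialGenerator

variable {G : C} {Γ : PolynomialGenerator k G} (K : ∀ r : ℕ, Γ.Cone (r + 1))

variable {K} in
include K in
lemma gradedCenter_ext {n : ℤ} {η ζ : gradedCenter k C n} (h0 : component η G = component ζ G)
    (h : ∀ r, component η (K r).X = component ζ (K r).X) : η = ζ :=
  ext_of_family (factorsThrough_objs K) (fun | none => h0 | some r => h r)

lemma exists_socleElement (c : ℕ → k) : ∃ η : gradedCenter k C 0, component η G = 0 ∧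
    ∀ r, component η (K r).X = c r • (K r).socle := by
  obtain ⟨η, hη⟩ := exists_of_family k (factorsThrough_objs K) (commutes_family_socle K c)
  exact ⟨η, hη none, fun r => hη (some r)⟩

/-- The elements of degree `0` of the graded center which vanish on the generator. -/
noncomputable def socleElement : (ℕ → k) →ₗ[k] gradedCenter k C 0 where
  toFun c := (exists_socleElement K c).choose
  map_add' c c' := by
    have h1 := (exists_socleElement K c).choose_spec
    have h2 := (exists_socleElement K c').choose_spec
    have h3 := (exists_socleElement K (c + c')).choose_spec
    refine gradedCenter_ext (K := K) ?_ fun r => ?_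
    · rw [component_add, h1.1, h2.1, h3.1, add_zero]
    · rw [component_add, h1.2, h2.2, h3.2, Pi.add_apply, add_smul]
  map_smul' a c := by
    have h1 := (exists_socleElement K c).choose_spec
    have h3 := (exists_socleElement K (a • c)).choose_spec
    refine gradedCenter_ext (K := K) ?_ fun r => ?_
    · rw [component_smul, RingHom.id_apply, h1.1, h3.1, smul_zero]
    · rw [component_smul, RingHom.id_apply, h1.2, h3.2, Pi.smul_apply, smul_assoc]

lemma component_socleElement_generator (c : ℕ → k) : component (socleElement K c) G = 0 :=
  (exists_socleElement K c).choose_spec.1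

lemma component_socleElement (c : ℕ → k) (r : ℕ) :
    component (socleElement K c) (K r).X = c r • (K r).socle :=
  (exists_socleElement K c).choose_spec.2 r

lemma socleElement_injective : Function.Injective (socleElement K) := by
  rw [← LinearMap.ker_eq_bot, LinearMap.ker_eq_bot']
  intro c hc
  funext r
  have := component_socleElement K c r
  rw [hc, component_zero, eq_comm, smul_eq_zero] at this
  exact this.resolve_right ((K r).socle_ne_zero (by lia))

lemma exists_eq_socleElement (η : gradedCenter k C 0) (h0 : component η G = 0) :
    ∃ c, η = socleElement K c := by
  obtain ⟨c, hc⟩ := exists_component_cone K η h0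
  refine ⟨c, gradedCenter_ext (K := K) ?_ fun r => ?_⟩
  · rw [h0, component_socleElement_generator]
  · rw [hc, component_socleElement]

lemma exists_eq_smul_one_add (η : gradedCenter k C 0) :
    ∃ (a : k) (c : ℕ → k), η = a • gradedCenter.one k C + socleElement K c := by
  obtain ⟨a, ha⟩ := Γ.exists_smul (component η G)
  obtain ⟨c, hc⟩ := exists_eq_socleElement K (η - a • gradedCenter.one k C) (by
    rw [sub_eq_add_neg, ← neg_smul, component_add, component_smul, component_one, ha, Γ.z_zero,
      neg_smul, add_neg_cancel])
  exact ⟨a, c, by rw [← hc]; abel⟩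

lemma mul_socleElement_eq_zero {d e : ℤ} (hd : 0 < d) (η : gradedCenter k C d) (c : ℕ → k)
    (h : d + 0 = e) : gradedCenter.mul η (socleElement K c) h = 0 := by
  refine gradedCenter_ext (K := K) ?_ fun r => ?_
  · rw [component_mul, component_socleElement_generator, comp_zero, component_zero]
  · rw [component_mul, component_socleElement, comp_smul,
      Cone.comp_socle_eq_zero (by lia) (by lia) hd.le (by lia), smul_zero, component_zero]

lemma socleElement_mul_eq_zero {d e : ℤ} (hd : 0 < d) (η : gradedCenter k C d) (c : ℕ → k)
    (h : 0 + d = e) : gradedCenter.mul (socleElement K c) η h = 0 := by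
  refine gradedCenter_ext (K := K) ?_ fun r => ?_
  · rw [component_mul, component_socleElement_generator, zero_comp, component_zero]
  · rw [component_mul, component_socleElement, smul_comp,
      Cone.socle_comp_eq_zero (by lia) (by lia) hd.le (by lia), smul_zero, component_zero]

lemma socleElement_mul_socleElement (c c' : ℕ → k) {e : ℤ} (h : 0 + 0 = e) :
    gradedCenter.mul (socleElement K c) (socleElement K c') h = 0 := by
  refine gradedCenter_ext (K := K) ?_ fun r => ?_
  · rw [component_mul, component_socleElement_generator, zero_comp, component_zero]
  · rw [component_mul, component_socleElement, component_socleElement, smul_comp, comp_smul,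
      Cone.socle_comp_socle, smul_zero, smul_zero, component_zero]

/-- The inclusion of the square-zero ideal in the graded center. -/
noncomputable def socleMap : (ℕ → k) →ₗ[k] GradedCenter k C :=
  DirectSum.lof k ℤ (fun n : ℤ => gradedCenter k C n) 0 ∘ₗ socleElement K

lemma socleMap_apply (c : ℕ → k) : socleMap K c = 
    DirectSum.lof k ℤ (fun n : ℤ => gradedCenter k C n) 0 (socleElement K c) := rfl

lemma of_mul {a b : ℤ} (η : gradedCenter k C a) (ζ : gradedCenter k C b) :
    DirectSum.lof k ℤ (fun n : ℤ => gradedCenter k C n) a η *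
      DirectSum.lof k ℤ (fun n : ℤ => gradedCenter k C n) b ζ =
      DirectSum.lof k ℤ (fun n : ℤ => gradedCenter k C n) (a + b) (gradedCenter.mul η ζ rfl) :=
  DirectSum.of_mul_of _ _

lemma socleMap_mul_socleMap (c c' : ℕ → k) : socleMap K c * socleMap K c' = 0 := by
  rw [socleMap_apply, socleMap_apply, of_mul, socleElement_mul_socleElement, _root_.map_zero]

lemma smul_eq_algebraMap_mul (r : k) (x : GradedCenter k C) :
    r • x = algebraMap k (GradedCenter k C) r * x := Algebra.smul_def r x

/-- The degree `0` part of the graded center as a trivial extension. -/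
noncomputable def ofTrivSqZeroExt : TrivSqZeroExt k (ℕ → k) →ₐ[k] GradedCenter k C :=
  TrivSqZeroExt.lift (Algebra.ofId k _) (socleMap K) (socleMap_mul_socleMap K)
    (fun r c => by
      rw [_root_.map_smul, Algebra.ofId_apply]; exact smul_eq_algebraMap_mul _ _)
    (fun r c => by
      rw [op_smul_eq_smul, _root_.map_smul, Algebra.ofId_apply, ← Algebra.commutes]
      exact smul_eq_algebraMap_mul _ _)

lemma algebraMap_eq_lof (a : k) : algebraMap k (GradedCenter k C) a =
    DirectSum.lof k ℤ (fun n : ℤ => gradedCenter k C n) 0 (a • gradedCenter.one k C) := rfl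

lemma ofTrivSqZeroExt_apply (t : TrivSqZeroExt k (ℕ → k)) : ofTrivSqZeroExt K t =
    DirectSum.lof k ℤ (fun n : ℤ => gradedCenter k C n) 0
      (t.fst • gradedCenter.one k C + socleElement K t.snd) := by
  rw [_root_.map_add]
  rfl

include K in
lemma smul_one_add_injective {a : k} {c : ℕ → k}
    (h : a • gradedCenter.one k C + socleElement K c = 0) : a = 0 ∧ c = 0 := by
  have h0 := congrArg (fun η => component η G) h
  simp only [component_add, component_smul, component_one, component_socleElement_generator,
    add_zero, component_zero, ← Γ.z_zero] at h0
  obtain rfl := (smul_eq_zero.1 h0).resolve_right (Γ.z_ne_zero le_rfl)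
  rw [zero_smul, zero_add] at h
  exact ⟨rfl, socleElement_injective K (by rw [h, _root_.map_zero])⟩

variable (Γ) in
include Γ in
theorem nonempty_degreeZero_algEquiv :
    Nonempty (GradedCenter.degreeZero k C ≃ₐ[k] TrivSqZeroExt k (ℕ → k)) := by
  let K := fun r : ℕ => (Γ.nonempty_cone (r + 1)).some
  have hinj : Function.Injective (ofTrivSqZeroExt K) := by
    rw [injective_iff_map_eq_zero]
    intro t ht
    rw [ofTrivSqZeroExt_apply,
      ← _root_.map_zero (DirectSum.lof k ℤ (fun n : ℤ => gradedCenter k C n) 0)] at ht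
    obtain ⟨h1, h2⟩ := smul_one_add_injective K
      (DirectSum.of_injective (β := fun n : ℤ => gradedCenter k C n) 0 ht)
    exact TrivSqZeroExt.ext h1 h2
  have hr : (ofTrivSqZeroExt K).range = GradedCenter.degreeZero k C := by
    ext x
    constructor
    · rintro ⟨t, rfl⟩
      exact ⟨_, (ofTrivSqZeroExt_apply K t).symm⟩
    · rintro ⟨η, rfl⟩
      obtain ⟨a, c, rfl⟩ := exists_eq_smul_one_add K η
      exact ⟨(a, c), ofTrivSqZeroExt_apply K _⟩
  exact ⟨((AlgEquiv.ofInjective _ hinj).trans (Subalgebra.equivOfEq _ _ hr)).symm⟩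

end PolynomialGenerator

end CategoryTheory.ShiftedHom

/-! ### The isomorphism with the trivial extension of k[ζ] -/

namespace CategoryTheory.ShiftedHom

open Pretriangulated gradedCenter

variable {k : Type u} [Field k] {C : Type*} [Category* C] [HasShift C ℤ] [Preadditive C]
  [Linear k C] [∀ n : ℤ, (shiftFunctor C n).Additive] [∀ n : ℤ, (shiftFunctor C n).Linear k]
  [Limits.HasZeroObject C] [Pretriangulated C]

namespace PolynomialGenerator

variable {G : C} {Γ : PolynomialGenerator k G}
  (K : ∀ r : ℕ, Γ.Cone (r + 1))

variable (k) in
/-- The residue field of `k[ζ]` at `ζ = 0`. -/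
noncomputable def residueEquiv : (k[X] ⧸ Ideal.span {(X : k[X])}) ≃ₐ[k] k :=
  (Ideal.quotientEquivAlgOfEq k (by rw [C_0, sub_zero])).trans (quotientSpanXSubCAlgEquiv (0 : k))

lemma residueEquiv_smul (p : k[X]) (x : k[X] ⧸ Ideal.span {(X : k[X])}) :
    residueEquiv k (p • x) = p.coeff 0 * residueEquiv k x := by
  have key (q : k[X]) : residueEquiv k (Ideal.Quotient.mk _ q) = q.coeff 0 := by
    rw [residueEquiv, AlgEquiv.trans_apply, Ideal.quotientEquivAlgOfEq_mk,
      quotientSpanXSubCAlgEquiv_mk, coeff_zero_eq_eval_zero]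
  obtain ⟨q, rfl⟩ := Ideal.Quotient.mk_surjective x
  have h : p • (Ideal.Quotient.mk (Ideal.span {(X : k[X])}) q) = Ideal.Quotient.mk _ (p * q) := rfl
  rw [h, key, key, mul_coeff_zero]

include K in
variable {K} in
lemma exists_zElement {d : ℤ} (hd : ∀ {X Y : C} (f : X ⟶ Y), d.negOnePow • f = f) (hd' : 0 < d) :
    ∃ η : gradedCenter k C d, component η G = Γ.z d := by
  obtain ⟨x, -, hx⟩ := exists_family_z K (d := d) hd hd'
  obtain ⟨η, hη⟩ := exists_of_family k (factorsThrough_objs K) hx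
  exact ⟨η, hη none⟩

variable {K} in
lemma exists_pow_eq {d : ℕ} {η : gradedCenter k C (d : ℤ)} (hη : component η G = Γ.z d) (i : ℕ)
    {n : ℤ} (hn : n = d * i) : ∃ ξ : gradedCenter k C n, component ξ G = Γ.z n ∧
      DirectSum.lof k ℤ (fun n : ℤ => gradedCenter k C n) d η ^ i =
        DirectSum.lof k ℤ (fun n : ℤ => gradedCenter k C n) n ξ := by
  induction i generalizing n with
  | zero =>
    obtain rfl : n = 0 := by lia
    exact ⟨gradedCenter.one k C, by rw [component_one, Γ.z_zero], pow_zero _⟩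
  | succ i ih =>
    obtain ⟨ξ, hξ, hξ'⟩ := ih rfl
    obtain rfl : n = d * i + d := by rw [hn]; push_cast; ring
    refine ⟨gradedCenter.mul ξ η rfl, ?_, by rw [pow_succ, hξ', of_mul]⟩
    rw [component_mul, hξ, hη, Γ.z_comp_z (by positivity) (by positivity)]

/-- The square-zero ideal, as a module over the polynomial ring. -/
noncomputable def residueMap :
    (ℕ → k[X] ⧸ Ideal.span {(X : k[X])}) →ₗ[k] GradedCenter k C :=
  socleMap K ∘ₗ (LinearEquiv.piCongrRight fun _ : ℕ => (residueEquiv k).toLinearEquiv).toLinearMap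

lemma residueMap_apply (x : ℕ → k[X] ⧸ Ideal.span {(X : k[X])}) :
    residueMap K x = socleMap K (fun r => residueEquiv k (x r)) := rfl

lemma residueMap_smul (p : k[X]) (x : ℕ → k[X] ⧸ Ideal.span {(X : k[X])}) :
    residueMap K (p • x) = p.coeff 0 • residueMap K x := by
  rw [residueMap_apply, residueMap_apply, ← _root_.map_smul]
  congr 1
  funext r
  exact residueEquiv_smul p (x r)

/-- An element of positive degree kills the socle elements, so only the constant term of `p` acts.
-/
lemma aeval_mul_socleMap {d : ℤ} (hd : 0 < d) (η : gradedCenter k C d) (p : k[X]) (c : ℕ → k) :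
    aeval (DirectSum.lof k ℤ (fun n : ℤ => gradedCenter k C n) d η) p * socleMap K c =
      p.coeff 0 • socleMap K c := by
  conv_lhs => rw [← divX_mul_X_add p]
  rw [_root_.map_add, _root_.map_mul, aeval_X, aeval_C, add_mul, mul_assoc, socleMap_apply, of_mul,
    mul_socleElement_eq_zero K hd, _root_.map_zero, mul_zero, zero_add,
    smul_eq_algebraMap_mul]

lemma socleMap_mul_aeval {d : ℤ} (hd : 0 < d) (η : gradedCenter k C d) (p : k[X]) (c : ℕ → k) :
    socleMap K c * aeval (DirectSum.lof k ℤ (fun n : ℤ => gradedCenter k C n) d η) p =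
      p.coeff 0 • socleMap K c := by
  conv_lhs => rw [← X_mul_divX_add p]
  rw [_root_.map_add, _root_.map_mul, aeval_X, aeval_C, mul_add, ← mul_assoc, socleMap_apply,
    of_mul, socleElement_mul_eq_zero K hd, _root_.map_zero, zero_mul, zero_add,
    ← Algebra.commutes, smul_eq_algebraMap_mul]

/-- The homomorphism from the trivial extension to the graded center. -/
noncomputable def ofTrivExt {d : ℕ} (hd : 0 < (d : ℤ)) (η : gradedCenter k C (d : ℤ)) :
    TrivExt k →ₐ[k] GradedCenter k C :=
  TrivSqZeroExt.lift (aeval (DirectSum.lof k ℤ (fun n : ℤ => gradedCenter k C n) d η))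
    (residueMap K) (fun x y => socleMap_mul_socleMap K _ _)
    (fun p x => by rw [residueMap_smul, residueMap_apply, aeval_mul_socleMap K hd])
    (fun p x => by
      rw [op_smul_eq_smul, residueMap_smul, residueMap_apply, socleMap_mul_aeval K hd])

lemma ofTrivExt_apply {d : ℕ} (hd : 0 < (d : ℤ)) (η : gradedCenter k C (d : ℤ)) (t : TrivExt k) :
    ofTrivExt K hd η t = aeval (DirectSum.lof k ℤ (fun n : ℤ => gradedCenter k C n) d η) t.fst +
      residueMap K t.snd := rfl

section Bijective

variable {d : ℕ} (hd : 0 < (d : ℤ)) {η : gradedCenter k C (d : ℤ)}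

lemma residueMap_eq_lof (x : ℕ → k[X] ⧸ Ideal.span {(X : k[X])}) : residueMap K x =
    DirectSum.lof k ℤ (fun n : ℤ => gradedCenter k C n) 0
      (socleElement K (fun r => residueEquiv k (x r))) := rfl

lemma ofTrivExt_mem (hη : component η G = Γ.z d) {n : ℤ} {t : TrivExt k}
    (ht : t ∈ TrivExt.homogeneous k d n) :
    ofTrivExt K hd η t ∈ GradedCenter.homogeneous k C n := by
  rw [ofTrivExt_apply]
  refine Submodule.add_mem _ ?_ ?_
  · rw [aeval_eq_sum_range]
    refine Submodule.sum_mem _ fun i _ => ?_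
    by_cases hi : (d * i : ℤ) = n
    · obtain ⟨ξ, -, hξ⟩ := exists_pow_eq hη i rfl
      subst hi
      refine Submodule.smul_mem _ _ ⟨ξ, hξ.symm⟩
    · rw [ht.1 i hi, zero_smul]
      exact Submodule.zero_mem _
  · by_cases hn : n = 0
    · subst hn
      exact ⟨_, (residueMap_eq_lof K _).symm⟩
    · rw [ht.2 hn, _root_.map_zero]
      exact Submodule.zero_mem _

/-- The polynomial part is read off at `G`, where the i-th power of `η` is the nonzero z^(di) and
socle elements vanish. The remaining part is detected on the cones. -/
lemma ofTrivExt_injective (hη : component η G = Γ.z d) :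
    Function.Injective (ofTrivExt K hd η) := by
  rw [injective_iff_map_eq_zero]
  intro t ht
  rw [ofTrivExt_apply] at ht
  have hp : t.fst = 0 := by
    ext i
    obtain ⟨n, hn⟩ : ∃ n : ℤ, n = d * i := ⟨_, rfl⟩
    let E : GradedCenter k C →ₗ[k] ShiftedHom G G n := componentₗ k n G ∘ₗ
      DirectSum.component k ℤ (fun n : ℤ => gradedCenter k C n) n
    have hE (ξ : gradedCenter k C n) :
        E (DirectSum.lof k ℤ (fun n : ℤ => gradedCenter k C n) n ξ) = component ξ G :=
      congrArg (componentₗ k n G) 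
        (DirectSum.component.lof_self (M := fun n : ℤ => gradedCenter k C n) k n ξ)
    have hE' {m : ℤ} (hm : m ≠ n) (ξ : gradedCenter k C m) :
        E (DirectSum.lof k ℤ (fun n : ℤ => gradedCenter k C n) m ξ) = 0 :=
      (congrArg (componentₗ k n G) ((DirectSum.component.of
        (M := fun n : ℤ => gradedCenter k C n) k n m ξ).trans (dif_neg hm))).trans
        (_root_.map_zero _)
    have h1 : E (residueMap K t.snd) = 0 := by
      rw [residueMap_eq_lof]
      by_cases hn0 : n = 0
      · subst hn0
        rw [hE, component_socleElement_generator]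
      · exact hE' (Ne.symm hn0) _
    have h2 := congrArg E ht
    obtain ⟨ξ, hξ, hξ'⟩ := exists_pow_eq hη i hn
    rw [_root_.map_add, h1, add_zero, aeval_eq_sum_range, _root_.map_sum,
      Finset.sum_eq_single i, hξ', _root_.map_smul, hE, hξ, _root_.map_zero, smul_eq_zero] at h2
    · exact h2.resolve_right (Γ.z_ne_zero (by rw [hn]; positivity))
    · intro j _ hj
      obtain ⟨ω, -, hω⟩ := exists_pow_eq hη j rfl
      rw [hω, _root_.map_smul, hE', smul_zero]
      rw [hn]
      exact fun h => hj (by exact_mod_cast mul_left_cancel₀ hd.ne' h)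
    · intro hi
      rw [coeff_eq_zero_of_natDegree_lt (by simpa using hi), zero_smul, _root_.map_zero]
  rw [hp, _root_.map_zero, zero_add, residueMap_eq_lof,
    ← _root_.map_zero (DirectSum.lof k ℤ (fun n : ℤ => gradedCenter k C n) 0)] at ht
  have h3 := socleElement_injective K ((DirectSum.of_injective
    (β := fun n : ℤ => gradedCenter k C n) 0 ht).trans (_root_.map_zero _).symm)
  refine TrivSqZeroExt.ext hp (funext fun r => (residueEquiv k).injective ?_)
  exact (congrFun h3 r).trans (_root_.map_zero _).symm

include K in
lemma eq_zero_of_component_generator {n : ℤ} (hn : n ≠ 0) (ξ : gradedCenter k C n)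
    (h0 : component ξ G = 0) : ξ = 0 :=
  gradedCenter_ext (K := K) h0 (component_cone_eq_zero K hn ξ h0)

/-- In degree n ≠ 0 a central element is determined by its component at `G`, a multiple of z^n;
unless this is zero, d divides n and a power of `η` has the same component up to a scalar. -/
lemma exists_ofTrivExt_eq (hη : component η G = Γ.z d)
    (hdvd : ∀ {n : ℤ} (ξ : gradedCenter k C n), ¬ (d : ℤ) ∣ n → component ξ G = 0) {n : ℤ}
    (ξ : gradedCenter k C n) : ∃ t ∈ TrivExt.homogeneous k d n, ofTrivExt K hd η t =
      DirectSum.lof k ℤ (fun n : ℤ => gradedCenter k C n) n ξ := by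
  by_cases hn : n = 0
  · subst hn
    obtain ⟨a, c, rfl⟩ := exists_eq_smul_one_add K ξ
    refine ⟨TrivSqZeroExt.inl (Polynomial.C a) +
      TrivSqZeroExt.inr (fun r => (residueEquiv k).symm (c r)),
      ⟨fun i hi => ?_, fun h => (h rfl).elim⟩, ?_⟩
    · rw [TrivSqZeroExt.fst_add, TrivSqZeroExt.fst_inl, TrivSqZeroExt.fst_inr, add_zero]
      exact coeff_C_of_ne_zero (by rintro rfl; simp at hi)
    · rw [ofTrivExt_apply, _root_.map_add, residueMap_eq_lof, TrivSqZeroExt.fst_add,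
        TrivSqZeroExt.fst_inl, TrivSqZeroExt.fst_inr, add_zero, TrivSqZeroExt.snd_add,
        TrivSqZeroExt.snd_inl, TrivSqZeroExt.snd_inr, zero_add]
      simp only [AlgEquiv.apply_symm_apply, aeval_C, algebraMap_eq_lof]
  by_cases h0 : component ξ G = 0
  · rw [eq_zero_of_component_generator K hn ξ h0]
    exact ⟨0, Submodule.zero_mem _, by rw [_root_.map_zero, _root_.map_zero]⟩
  have hn0 : 0 ≤ n := by
    by_contra! h
    exact h0 (Γ.eq_zero h _)
  obtain ⟨i, rfl⟩ : (d : ℤ) ∣ n := by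
    by_contra h
    exact h0 (hdvd ξ h)
  obtain ⟨i, rfl⟩ := Int.eq_ofNat_of_zero_le (nonneg_of_mul_nonneg_right hn0 hd)
  obtain ⟨c, hc⟩ := Γ.exists_smul (component ξ G)
  obtain ⟨ω, hω, hω'⟩ := exists_pow_eq hη i rfl
  have hξ : ξ - c • ω = 0 := eq_zero_of_component_generator K hn _ (by
    rw [sub_eq_add_neg, ← neg_smul, component_add, component_smul, hω, hc, neg_smul,
      add_neg_cancel])
  refine ⟨TrivSqZeroExt.inl (monomial i c), ⟨fun j hj => ?_, fun _ => rfl⟩, ?_⟩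
  · refine coeff_monomial_of_ne _ ?_
    rintro rfl
    exact hj rfl
  · rw [ofTrivExt_apply, sub_eq_zero.1 hξ, _root_.map_smul]
    rw [TrivSqZeroExt.fst_inl, TrivSqZeroExt.snd_inl, _root_.map_zero, add_zero, aeval_monomial,
      hω', smul_eq_algebraMap_mul]

variable (Γ) in
include Γ in
theorem exists_algEquiv (hd : 0 < d)
    (hd' : ∀ {X Y : C} (f : X ⟶ Y), (d : ℤ).negOnePow • f = f)
    (hdvd : ∀ {n : ℤ} (ξ : gradedCenter k C n), ¬ (d : ℤ) ∣ n → component ξ G = 0) :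
    ∃ Φ : GradedCenter k C ≃ₐ[k] TrivExt k, ∀ n : ℤ,
      (GradedCenter.homogeneous k C n).map Φ.toLinearMap = TrivExt.homogeneous k d n := by
  let K := fun r : ℕ => (Γ.nonempty_cone (r + 1)).some
  replace hd : 0 < (d : ℤ) := by exact_mod_cast hd
  obtain ⟨η, hη⟩ := exists_zElement (K := K) hd' hd
  let Ψ := ofTrivExt K hd η
  have hΨ : Function.Surjective Ψ := by
    intro x
    induction x using DirectSum.induction_on with
    | zero => exact ⟨0, _root_.map_zero _⟩
    | of n ξ =>
      obtain ⟨t, -, ht⟩ := exists_ofTrivExt_eq K hd hη hdvd ξ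
      exact ⟨t, ht⟩
    | add x y hx hy =>
      obtain ⟨s, rfl⟩ := hx
      obtain ⟨t, rfl⟩ := hy
      exact ⟨s + t, _root_.map_add _ _ _⟩
  let e := AlgEquiv.ofBijective Ψ ⟨ofTrivExt_injective K hd hη, hΨ⟩
  refine ⟨e.symm, fun n => le_antisymm ?_ fun t ht => ?_⟩
  · rintro _ ⟨_, ⟨ξ, rfl⟩, rfl⟩
    obtain ⟨t, ht, h⟩ := exists_ofTrivExt_eq K hd hη hdvd ξ
    rw [← h]
    change e.symm (e t) ∈ _
    rwa [e.symm_apply_apply]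
  · exact ⟨e t, ofTrivExt_mem K hd hη ht, e.symm_apply_apply t⟩

variable (Γ) in
include Γ in
theorem exists_algEquiv_of_ringChar :
    ∃ Φ : GradedCenter k C ≃ₐ[k] TrivExt k, ∀ n : ℤ,
      (GradedCenter.homogeneous k C n).map Φ.toLinearMap =
        TrivExt.homogeneous k (if ringChar k = 2 then 1 else 2) n := by
  split_ifs with h
  · refine Γ.exists_algEquiv one_pos (fun {X Y} f => ?_) fun ξ hξ => (hξ (by simp)).elim
    have h2 : (2 : k) = 0 := by
      have := ringChar.Nat.cast_ringChar (R := k)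
      rwa [h] at this
    have : (2 : k) • f = 0 := by rw [h2, zero_smul]
    rw [two_smul] at this
    rw [Nat.cast_one, Int.negOnePow_one, Units.neg_smul, one_smul]
    exact neg_eq_of_add_eq_zero_left this
  · refine Γ.exists_algEquiv two_pos (fun {X Y} f => ?_) fun ξ hξ =>
      Γ.component_generator_eq_zero_of_odd (Ring.two_ne_zero h) ?_ ξ
    · rw [Int.negOnePow_even _ (by decide), one_smul]
    · rw [← Int.not_even_iff_odd, even_iff_two_dvd]
      exact hξ

end Bijective

end PolynomialGenerator

end CategoryTheory.ShiftedHom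

/-! ### Polynomial endomorphism rings from a self-extension -/

namespace CategoryTheory.ShiftedHom

open Pretriangulated

section

variable {C : Type*} [Category* C] [HasShift C ℤ] [Preadditive C] {G : C}

/-- The iterated compositions of a morphism of degree `1`. -/
noncomputable def natPow (δ : ShiftedHom G G (1 : ℤ)) : ∀ n : ℕ, ShiftedHom G G (n : ℤ)
  | 0 => mk₀ _ rfl (𝟙 G)
  | n + 1 => δ.comp (natPow δ n) rfl

/-- The iterated compositions of a morphism of degree `1`, extended by zero. -/
noncomputable def intPow (δ : ShiftedHom G G (1 : ℤ)) : ∀ n : ℤ, ShiftedHom G G n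
  | .ofNat n => natPow δ n
  | .negSucc _ => 0

lemma intPow_zero (δ : ShiftedHom G G (1 : ℤ)) : intPow δ 0 = gid G := rfl

lemma intPow_succ (δ : ShiftedHom G G (1 : ℤ)) {a c : ℤ} (ha : 0 ≤ a) (h : a + 1 = c) :
    intPow δ c = δ.comp (intPow δ a) h := by
  obtain ⟨n, rfl⟩ := Int.eq_ofNat_of_zero_le ha
  subst h
  rfl

variable [∀ n : ℤ, (shiftFunctor C n).Additive]

lemma intPow_comp_intPow (δ : ShiftedHom G G (1 : ℤ)) {a b c : ℤ} (ha : 0 ≤ a) (hb : 0 ≤ b)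
    (h : b + a = c) : (intPow δ a).comp (intPow δ b) h = intPow δ c := by
  obtain ⟨n, rfl⟩ := Int.eq_ofNat_of_zero_le ha
  clear ha
  induction n generalizing c with
  | zero =>
    obtain rfl : c = b := by lia
    exact gid_comp _ _
  | succ n ih =>
    rw [intPow_succ δ (a := n) (by lia) (by lia), assoc_r (b + n) rfl, ih,
      ← intPow_succ δ (by lia)]

end

variable {k : Type*} [Field k] {C : Type*} [Category* C] [HasShift C ℤ] [Preadditive C]
  [Linear k C] [∀ n : ℤ, (shiftFunctor C n).Additive] [∀ n : ℤ, (shiftFunctor C n).Linear k]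
  [Limits.HasZeroObject C] [Pretriangulated C] {G P : C}

/-- A self-extension of `G` by an object without morphisms of positive degree to `G` makes the
graded endomorphism ring of `G` a polynomial ring. -/
noncomputable def PolynomialGenerator.ofDistTriang {f : G ⟶ P} {g : P ⟶ G}
    {δ : G ⟶ G⟦(1 : ℤ)⟧} (hT : Triangle.mk f g δ ∈ distTriang C)
    (hf : ∀ v : P ⟶ G, f ≫ v = 0)
    (hP : ∀ {n : ℤ}, 0 < n → ∀ u : ShiftedHom P G n, u = 0)
    (hG : ∀ {n : ℤ}, n < 0 → ∀ u : ShiftedHom G G n, u = 0)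
    (hend : ∀ u : G ⟶ G, ∃ c : k, u = c • 𝟙 G) (h0 : 𝟙 G ≠ 0)
    (hgen : ∀ P : C → Prop, P G → (∀ {X Y : C} {n m : ℤ}, GIso X Y n m → P X → P Y) →
      (∀ {X Y Z : C} (f : X ⟶ Y) (g : Y ⟶ Z) (h : Z ⟶ X⟦(1 : ℤ)⟧),
        Triangle.mk f g h ∈ distTriang C → P X → P Z → P Y) → ∀ X, P X) :
    PolynomialGenerator k G where
  z := intPow δ
  z_zero := intPow_zero δ
  z_comp_z := intPow_comp_intPow δ
  z_ne_zero {n} hn := by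
    have H := isExactAt_of_distTriang₃ hT
    obtain ⟨n, rfl⟩ := Int.eq_ofNat_of_zero_le hn
    clear hn
    have hz : gid G ≠ 0 := fun h => h0 ((homEquiv (X := G) (Y := G) (0 : ℤ) rfl).injective
      (h.trans (mk₀_zero (C := C) (X := G) (Y := G) (0 : ℤ) rfl).symm))
    induction n with
    | zero => exact hz
    | succ n ih =>
      intro h
      rw [intPow_succ δ (a := n) (by lia) (by lia)] at h
      -- If δ^(n+1) = 0 then δ^n factors through `f` and a morphism from `P` to `G` of degree n:
      -- this is zero for n > 0 by `hP`, and for n = 0 by `hf`.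
      obtain ⟨v, hv⟩ := H.desc _ (add_zero (n : ℤ)) _ h
      obtain hn | hn := Nat.eq_zero_or_pos n
      · subst hn
        obtain ⟨v, rfl⟩ := (homEquiv (X := P) (Y := G) (0 : ℤ) rfl).surjective v
        refine hz (hv.trans ?_)
        change (mk₀ (0 : ℤ) rfl f).comp (mk₀ (0 : ℤ) rfl v) _ = 0
        rw [mk₀_comp_mk₀, hf, mk₀_zero]
      · rw [hP (by lia) v, comp_zero] at hv
        exact ih hv
  eq_zero := hG
  exists_smul {n} u := by
    obtain hn | hn := lt_or_ge n 0
    · exact ⟨0, by rw [hG hn u, zero_smul]⟩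
    obtain ⟨n, rfl⟩ := Int.eq_ofNat_of_zero_le hn
    clear hn
    induction n with
    | zero =>
      obtain ⟨u, rfl⟩ := (homEquiv (X := G) (Y := G) (0 : ℤ) rfl).surjective u
      obtain ⟨c, rfl⟩ := hend u
      refine ⟨c, ?_⟩
      change mk₀ (0 : ℤ) rfl _ = c • mk₀ (0 : ℤ) rfl (𝟙 G)
      rw [mk₀_smul]
    | succ n ih =>
      -- In positive degree `g` followed by `u` vanishes, so `u` is divisible by `δ`.
      obtain ⟨v, hv⟩ := (isExactAt_of_distTriang₂ hT).desc u (n := n) (by lia) (add_zero _)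
        (hP (by positivity) _)
      obtain ⟨c, rfl⟩ := ih v
      exact ⟨c, by rw [hv, comp_smul, ← intPow_succ δ (by lia)]⟩
  generates := hgen

end CategoryTheory.ShiftedHom

/-! ### The bounded derived category of an abelian category -/

namespace CategoryTheory.ObjectProperty

open Pretriangulated

variable {C : Type*} [Category* C] [HasShift C ℤ] [Preadditive C] [Limits.HasZeroObject C]
  [∀ n : ℤ, (shiftFunctor C n).Additive] [Pretriangulated C] (P : ObjectProperty C)
  [P.IsTriangulated]

lemma distTriang_of_ι {X Y Z : P.FullSubcategory} {f : X.obj ⟶ Y.obj} {g : Y.obj ⟶ Z.obj}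
    {h : Z.obj ⟶ X.obj⟦(1 : ℤ)⟧} (hT : Triangle.mk f g h ∈ distTriang C) :
    Triangle.mk (P.homMk f : X ⟶ Y) (P.homMk g : Y ⟶ Z)
      (P.homMk (h ≫ (P.ι.commShiftIso (1 : ℤ)).inv.app X) : Z ⟶ X⟦(1 : ℤ)⟧) ∈
        distTriang P.FullSubcategory := by
  refine isomorphic_distinguished _ hT _
    (Triangle.isoMk _ _ (Iso.refl _) (Iso.refl _) (Iso.refl _) ?_ ?_ ?_)
  · exact (Category.comp_id _).trans (Category.id_comp _).symm
  · exact (Category.comp_id _).trans (Category.id_comp _).symm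
  · refine (congrArg (_ ≫ ·) (Functor.map_id _ _)).trans
      ((Category.comp_id _).trans (Eq.trans ?_ (Category.id_comp _).symm))
    change (h ≫ (P.ι.commShiftIso (1 : ℤ)).inv.app X) ≫ (P.ι.commShiftIso (1 : ℤ)).hom.app X = h
    rw [Category.assoc, Iso.inv_hom_id_app]
    exact Category.comp_id _

lemma shiftedHom_eq_zero {X Y : P.FullSubcategory} {n : ℤ}
    (h : ∀ f : X.obj ⟶ Y.obj⟦n⟧, f = 0) (f : ShiftedHom X Y n) : f = 0 := by
  apply P.ι.map_injective
  rw [← cancel_mono ((P.ι.commShiftIso n).hom.app Y), Functor.map_zero, Limits.zero_comp]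
  exact h _

end CategoryTheory.ObjectProperty

namespace DerivedCategory

open Pretriangulated ShiftedHom Triangulated

variable {A : Type*} [Category* A] [Abelian A] [HasDerivedCategory.{w} A]

/-- An object of an abelian category, as an object of the bounded derived category. -/
noncomputable def boundedSingle (M : A) : Bounded A :=
  ⟨(singleFunctor A 0).obj M, ⟨0, inferInstance⟩, ⟨0, inferInstance⟩⟩

lemma exists_boundedSingle_distTriang {S : ShortComplex A} (hS : S.ShortExact) :
    ∃ δ : boundedSingle S.X₃ ⟶ (boundedSingle S.X₁)⟦(1 : ℤ)⟧,
      Triangle.mk (ObjectProperty.homMk ((singleFunctor A 0).map S.f) :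
          boundedSingle S.X₁ ⟶ boundedSingle S.X₂)
        (ObjectProperty.homMk ((singleFunctor A 0).map S.g) :
          boundedSingle S.X₂ ⟶ boundedSingle S.X₃) δ ∈ distTriang (Bounded A) :=
  ⟨_, ObjectProperty.distTriang_of_ι (X := boundedSingle S.X₁) (Y := boundedSingle S.X₂)
    (Z := boundedSingle S.X₃) _ hS.singleTriangle_distinguished⟩

lemma boundedSingle_eq_zero_of_neg {M N : A} {n : ℤ} (hn : n < 0)
    (f : ShiftedHom (boundedSingle M) (boundedSingle N) n) : f = 0 := by
  suffices ∀ f : (singleFunctor A 0).obj M ⟶ ((singleFunctor A 0).obj N)⟦n⟧, f = 0 from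
    ObjectProperty.shiftedHom_eq_zero _ this f
  intro f
  have := TStructure.t.isGE_shift ((singleFunctor A 0).obj N) 0 n (-n)
  exact TStructure.t.zero f 0 (-n) (by lia)

lemma boundedSingle_eq_zero_of_projective {M N : A} [Projective M] {n : ℤ} (hn : 0 < n)
    (f : ShiftedHom (boundedSingle M) (boundedSingle N) n) : f = 0 := by
  suffices ∀ f : (singleFunctor A 0).obj M ⟶ ((singleFunctor A 0).obj N)⟦n⟧, f = 0 from
    ObjectProperty.shiftedHom_eq_zero _ this f
  intro f
  have := TStructure.t.isLE_shift ((singleFunctor A 0).obj N) 0 n (-n)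
  obtain ⟨L, _, ⟨e⟩⟩ := exists_iso_Q_obj_of_isLE (((singleFunctor A 0).obj N)⟦n⟧) (-n)
  let e' := (singleFunctorIsoCompQ A 0).app M
  have := from_singleFunctor_obj_eq_zero_of_projective (e'.inv ≫ f ≫ e.hom) (-n) (by lia)
  rw [← cancel_epi e'.inv, ← cancel_mono e.hom, Category.assoc, this]
  simp

lemma exists_boundedSingle_map_eq {M N : A} (f : boundedSingle M ⟶ boundedSingle N) :
    ∃ g : M ⟶ N, f = ObjectProperty.homMk ((singleFunctor A 0).map g) := by
  obtain ⟨g, hg⟩ := (singleFunctor A 0).map_surjective f.hom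
  exact ⟨g, by ext; exact hg.symm⟩

/-- The isomorphism of degree zero given by an isomorphism. -/
noncomputable def _root_.CategoryTheory.ShiftedHom.gIsoOfIso {C : Type*} [Category* C]
    [HasShift C ℤ] {X Y : C} (e : X ≅ Y) :
    GIso X Y 0 0 where
  hom := mk₀ 0 rfl e.hom
  inv := mk₀ 0 rfl e.inv
  sum := add_zero 0
  hom_inv := by rw [mk₀_comp_mk₀, e.hom_inv_id]
  inv_hom := by rw [mk₀_comp_mk₀, e.inv_hom_id]

/-- The bounded derived category is generated by the abelian category. -/
lemma bounded_induction (P : Bounded A → Prop) (h0 : ∀ M : A, P (boundedSingle M))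
    (hP : ∀ {X Y : Bounded A} {n m : ℤ}, GIso X Y n m → P X → P Y)
    (hT : ∀ {X Y Z : Bounded A} (f : X ⟶ Y) (g : Y ⟶ Z) (h : Z ⟶ X⟦(1 : ℤ)⟧),
      Triangle.mk f g h ∈ distTriang (Bounded A) → P X → P Z → P Y) (X : Bounded A) : P X := by
  have key₀ {a : ℤ} (X : Bounded A) [X.obj.IsGE a] [X.obj.IsLE a] : P X := by
    obtain ⟨M, ⟨e⟩⟩ := exists_iso_singleFunctor_obj_of_isGE_of_isLE X.obj a
    let e₁ : (boundedSingle M)⟦-a⟧ ≅ X := (TStructure.t.bounded).isoMk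
      ((Bounded.ι.commShiftIso (-a)).app (boundedSingle M) ≪≫
        ((singleFunctors A).shiftIso (-a) a 0 (by lia)).app M ≪≫ e.symm)
    exact hP (gIsoOfIso e₁) (hP (shiftGIso _ (-a)).symm (h0 M))
  have key (m : ℕ) (a : ℤ) (X : Bounded A) [X.obj.IsGE a] [X.obj.IsLE (a + m)] : P X := by
    induction m generalizing a X with
    | zero =>
      have : X.obj.IsLE a := by
        have := ‹X.obj.IsLE (a + (0 : ℕ))›
        rwa [Nat.cast_zero, add_zero] at this
      exact key₀ (a := a) X
    | succ m ih =>
      -- Truncation splits off the cohomology in degree `a` and shortens the amplitude by one.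
      have hT' := TStructure.t.triangleLEGT_distinguished a X.obj
      have : X.obj.IsLE (a + 1 + m) := by
        have := ‹X.obj.IsLE (a + (m + 1 : ℕ))›
        rwa [show a + (m + 1 : ℕ) = a + 1 + m by push_cast; ring] at this
      let Y : Bounded A := ⟨(TStructure.t.truncLE a).obj X.obj, ⟨a, inferInstance⟩,
        ⟨a, inferInstance⟩⟩
      let Z : Bounded A := ⟨(TStructure.t.truncGT a).obj X.obj, ⟨a + 1, inferInstance⟩,
        ⟨a + 1 + m, inferInstance⟩⟩
      have hY : Y.obj.IsGE a := inferInstanceAs (IsGE ((TStructure.t.truncLE a).obj X.obj) a)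
      have hY' : Y.obj.IsLE a := inferInstanceAs (IsLE ((TStructure.t.truncLE a).obj X.obj) a)
      have hZ : Z.obj.IsGE (a + 1) :=
        inferInstanceAs (IsGE ((TStructure.t.truncGT a).obj X.obj) (a + 1))
      have hZ' : Z.obj.IsLE (a + 1 + m) :=
        inferInstanceAs (IsLE ((TStructure.t.truncGT a).obj X.obj) (a + 1 + m))
      exact hT _ _ _ (ObjectProperty.distTriang_of_ι (X := Y) (Y := X) (Z := Z) _ hT')
        (key₀ (a := a) Y) (ih (a + 1) Z)
  obtain ⟨⟨a, ha⟩, ⟨b, hb⟩⟩ := X.property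
  have : X.obj.IsLE (a + (b - a).toNat) := TStructure.t.isLE_of_le X.obj b _ (by lia)
  exact key (b - a).toNat a X

end DerivedCategory

namespace DerivedCategory

variable {A : Type*} [Category* A] [Abelian A] [HasDerivedCategory.{w} A]

lemma boundedSingle_comp_eq_zero {L M N : A} {f : L ⟶ M} {g : M ⟶ N} (h : f ≫ g = 0) :
    (ObjectProperty.homMk ((singleFunctor A 0).map f) : boundedSingle L ⟶ boundedSingle M) ≫
      (ObjectProperty.homMk ((singleFunctor A 0).map g) : boundedSingle M ⟶ boundedSingle N) =
        0 := by
  refine ObjectProperty.hom_ext _ ?_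
  change (singleFunctor A 0).map f ≫ (singleFunctor A 0).map g = 0
  rw [← Functor.map_comp, h, Functor.map_zero]

lemma id_boundedSingle_eq_zero_iff {M : A} : 𝟙 (boundedSingle M) = 0 ↔ 𝟙 M = 0 := by
  constructor
  · intro h
    apply (singleFunctor A 0).map_injective
    rw [CategoryTheory.Functor.map_id, Functor.map_zero]
    exact congrArg (fun f => f.hom) h
  · intro h
    refine ObjectProperty.hom_ext _ ?_
    change 𝟙 ((singleFunctor A 0).obj M) = 0
    rw [← CategoryTheory.Functor.map_id, h, Functor.map_zero]

lemma boundedSingle_smul_id {k : Type*} [Ring k] [Linear k A] (M : A) (c : k) :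
    (ObjectProperty.homMk ((singleFunctor A 0).map (c • 𝟙 M)) :
      boundedSingle M ⟶ boundedSingle M) = c • 𝟙 (boundedSingle M) := by
  refine ObjectProperty.hom_ext _ ?_
  change (singleFunctor A 0).map (c • 𝟙 M) = c • 𝟙 ((singleFunctor A 0).obj M)
  rw [Functor.map_smul, CategoryTheory.Functor.map_id]

end DerivedCategory

/-! ### Modules over the dual numbers and the simple generator -/

namespace DualNumbers

variable (k : Type u) [Field k]

/-- The class of `x` in `k[x]/(x²)`. -/
noncomputable def x : DualNumbers k := Ideal.Quotient.mk _ X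

/-- The simple module over `k[x]/(x²)`. -/
abbrev Residue : Type u := DualNumbers k ⧸ Submodule.span (DualNumbers k) {x k}

variable {k}

lemma x_mul_x : x k * x k = 0 := by
  rw [x, ← map_mul, ← pow_two]
  exact Ideal.Quotient.eq_zero_iff_mem.2 (Ideal.mem_span_singleton_self _)

lemma x_ne_zero : x k ≠ 0 := by
  intro h
  rw [x, Ideal.Quotient.eq_zero_iff_mem, Ideal.mem_span_singleton] at h
  have := natDegree_le_of_dvd h X_ne_zero
  simp at this

lemma exists_eq (r : DualNumbers k) : ∃ (c : k) (s : DualNumbers k),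
    r = algebraMap k (DualNumbers k) c + s * x k := by
  obtain ⟨p, rfl⟩ := Ideal.Quotient.mk_surjective r
  refine ⟨p.coeff 0, Ideal.Quotient.mk _ p.divX, ?_⟩
  conv_lhs => rw [← divX_mul_X_add p]
  rw [map_add, map_mul, add_comm]
  rfl

section Module

variable {M : Type u} [AddCommGroup M] [Module (DualNumbers k) M] {m : M}

lemma x_smul_x_smul (m : M) : x k • x k • m = 0 := by
  have h : (x k * x k) • m = (0 : DualNumbers k) • m := congrArg (· • m) x_mul_x
  exact (mul_smul _ _ m).symm.trans (h.trans (zero_smul (DualNumbers k) m))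

lemma smul_eq_zero_iff (hm : m ≠ 0) (hx : x k • m = 0) (r : DualNumbers k) :
    r • m = 0 ↔ r ∈ Submodule.span (DualNumbers k) {x k} := by
  rw [Submodule.mem_span_singleton]
  constructor
  · intro h
    obtain ⟨c, s, rfl⟩ := exists_eq r
    rw [add_smul, mul_smul, hx, smul_zero, add_zero] at h
    by_cases hc : c = 0
    · exact ⟨s, by rw [hc, map_zero, zero_add, smul_eq_mul]⟩
    · refine absurd ?_ hm
      have := congrArg (algebraMap k (DualNumbers k) c⁻¹ • ·) h
      simpa only [smul_smul, ← map_mul, inv_mul_cancel₀ hc, map_one, one_smul, smul_zero] using this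
  · rintro ⟨s, rfl⟩
    rw [smul_eq_mul, mul_smul, hx, smul_zero]

variable (m) in
/-- The morphism from the simple module given by an element annihilated by `x`. -/
noncomputable def fromResidue (hx : x k • m = 0) : Residue k →ₗ[DualNumbers k] M :=
  Submodule.liftQ _ (LinearMap.toSpanSingleton (DualNumbers k) M m) (by
    rw [Submodule.span_singleton_le_iff_mem]
    exact hx)

lemma fromResidue_mk (hx : x k • m = 0) (r : DualNumbers k) :
    fromResidue m hx (Submodule.Quotient.mk r) = r • m := rfl

lemma fromResidue_injective (hm : m ≠ 0) (hx : x k • m = 0) :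
    Function.Injective (fromResidue m hx) := by
  rw [injective_iff_map_eq_zero]
  intro y hy
  obtain ⟨r, rfl⟩ := Submodule.Quotient.mk_surjective _ y
  rw [fromResidue_mk, smul_eq_zero_iff hm hx] at hy
  exact (Submodule.Quotient.mk_eq_zero _).2 hy

lemma exact_fromResidue (hx : x k • m = 0) :
    Function.Exact (fromResidue m hx) (Submodule.span (DualNumbers k) {m}).mkQ := by
  rw [LinearMap.exact_iff, Submodule.ker_mkQ, fromResidue, Submodule.range_liftQ,
    LinearMap.range_toSpanSingleton]

variable [Module.Finite (DualNumbers k) M]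

/-- The short exact sequence given by an element annihilated by `x`. -/
noncomputable abbrev shortComplex (hx : x k • m = 0) :
    ShortComplex (FGModuleCat.{u} (DualNumbers k)) :=
  ShortComplex.mk (FGModuleCat.ofHom (fromResidue m hx))
    (FGModuleCat.ofHom (Submodule.span (DualNumbers k) {m}).mkQ)
    (FGModuleCat.hom_ext (exact_fromResidue hx).linearMap_comp_eq_zero)

lemma shortExact (hm : m ≠ 0) (hx : x k • m = 0) : (shortComplex hx).ShortExact := by
  refine ShortExact.reflects_shortExact_of_faithful (forget₂ _ (ModuleCat.{u} (DualNumbers k))) ?_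
  exact ModuleCat.shortComplex_shortExact _ (exact_fromResidue hx)
    (fromResidue_injective hm hx) (Submodule.mkQ_surjective _)

end Module

instance : Projective (FGModuleCat.of (DualNumbers k) (DualNumbers k)) where
  factors {E X} f e _ := by
    have h1 : Epi ((forget₂ _ (ModuleCat.{u} (DualNumbers k))).map e) := inferInstance
    have h2 : Function.Surjective e.hom.hom := (ModuleCat.epi_iff_surjective _).1 h1
    obtain ⟨g, hg⟩ := Module.projective_lifting_property e.hom.hom f.hom.hom h2
    exact ⟨FGModuleCat.ofHom g, FGModuleCat.hom_ext hg⟩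

lemma exists_eq_smul_id (f : FGModuleCat.of (DualNumbers k) (Residue k) ⟶
    FGModuleCat.of (DualNumbers k) (Residue k)) : ∃ c : k, f = c • 𝟙 _ := by
  obtain ⟨r, hr⟩ := Submodule.Quotient.mk_surjective _ (f.hom.hom (Submodule.Quotient.mk 1))
  obtain ⟨c, s, rfl⟩ := exists_eq r
  refine ⟨c, FGModuleCat.hom_ext (Submodule.linearMap_qext _ (LinearMap.ext_ring ?_))⟩
  refine hr.symm.trans ?_
  change _ = algebraMap k (DualNumbers k) c • Submodule.Quotient.mk 1
  rw [← Submodule.Quotient.mk_smul, smul_eq_mul, mul_one, Submodule.Quotient.eq,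
    add_sub_cancel_left]
  exact Submodule.mem_span_singleton.2 ⟨s, rfl⟩

lemma id_residue_ne_zero : 𝟙 (FGModuleCat.of (DualNumbers k) (Residue k)) ≠ 0 := by
  intro h
  have h1 : (Submodule.Quotient.mk 1 : Residue k) = 0 :=
    congrArg (fun f => f.hom.hom (Submodule.Quotient.mk 1 : Residue k)) h
  rw [Submodule.Quotient.mk_eq_zero, ← smul_eq_zero_iff (m := x k) x_ne_zero x_mul_x,
    smul_eq_mul, one_mul] at h1
  exact x_ne_zero h1

/-- A morphism to the simple module sends x to x·v(1) = 0, and the submodule embedded here is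
generated by x. -/
lemma fromResidue_comp_eq_zero (v : FGModuleCat.of (DualNumbers k) (DualNumbers k) ⟶
    FGModuleCat.of (DualNumbers k) (Residue k)) :
    FGModuleCat.ofHom (fromResidue (x k) x_mul_x) ≫ v = 0 := by
  refine FGModuleCat.hom_ext (Submodule.linearMap_qext _ (LinearMap.ext_ring ?_))
  change v.hom.hom ((1 : DualNumbers k) • x k) = 0
  have h : v.hom.hom (x k) = x k • v.hom.hom (1 : DualNumbers k) := by
    have := v.hom.hom.map_smul (x k) (1 : DualNumbers k)
    rwa [smul_eq_mul, mul_one] at this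
  rw [one_smul, h]
  obtain ⟨r, hr⟩ := Submodule.Quotient.mk_surjective _ (v.hom.hom (1 : DualNumbers k))
  erw [← hr]
  rw [← Submodule.Quotient.mk_smul, Submodule.Quotient.mk_eq_zero]
  exact Submodule.mem_span_singleton.2 ⟨r, mul_comm _ _⟩

section Derived

open DerivedCategory ShiftedHom Pretriangulated ZeroObject

variable [HasDerivedCategory.{w} (FGModuleCat.{u} (DualNumbers k))]

lemma boundedSingle_induction (P : BoundedDerivedDual.{w} k → Prop)
    (h0 : P (boundedSingle (FGModuleCat.of (DualNumbers k) (Residue k))))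
    (hP : ∀ {X Y : BoundedDerivedDual.{w} k} {n m : ℤ}, GIso X Y n m → P X → P Y)
    (hT : ∀ {X Y Z : BoundedDerivedDual.{w} k} (f : X ⟶ Y) (g : Y ⟶ Z) (h : Z ⟶ X⟦(1 : ℤ)⟧),
      Triangle.mk f g h ∈ distTriang (BoundedDerivedDual.{w} k) → P X → P Z → P Y)
    (M : FGModuleCat.{u} (DualNumbers k)) : P (boundedSingle M) := by
  have hz : P 0 := hT _ _ _ (contractible_distinguished₂ _) h0 (hP (shiftGIso _ 1).symm h0)
  -- Noetherian induction on kernels of surjections from the fixed module `M`: dividing `M'` by an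
  -- element killed by x strictly enlarges the kernel, and the submodule divided out is simple.
  suffices ∀ (N : Submodule (DualNumbers k) M) (M' : Type u) [AddCommGroup M']
      [Module (DualNumbers k) M'] [Module.Finite (DualNumbers k) M'] (g : M →ₗ[DualNumbers k] M'),
      Function.Surjective g → LinearMap.ker g = N →
      P (boundedSingle (FGModuleCat.of (DualNumbers k) M')) from
    this ⊥ M LinearMap.id Function.surjective_id LinearMap.ker_id
  intro N
  induction N using WellFoundedGT.induction with
  | _ N ih =>
  intro M' _ _ _ g hg hN
  by_cases hM : ∀ m : M', m = 0
  · have : Limits.IsZero (boundedSingle (FGModuleCat.of (DualNumbers k) M')) := by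
      rw [Limits.IsZero.iff_id_eq_zero, id_boundedSingle_eq_zero_iff]
      exact FGModuleCat.hom_ext (LinearMap.ext hM)
    exact hP (gIsoOfIso (this.isoZero.symm)) hz
  obtain ⟨m, hm, hx⟩ : ∃ m : M', m ≠ 0 ∧ x k • m = 0 := by
    push Not at hM
    obtain ⟨m, hm⟩ := hM
    by_cases hx : x k • m = 0
    · exact ⟨m, hm, hx⟩
    · exact ⟨_, hx, x_smul_x_smul m⟩
  obtain ⟨δ, hδ⟩ := exists_boundedSingle_distTriang (shortExact hm hx)
  refine hT _ _ _ hδ h0 (ih _ ?_ _ ((Submodule.span (DualNumbers k) {m}).mkQ ∘ₗ g)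
    ((Submodule.mkQ_surjective _).comp hg) rfl)
  obtain ⟨m', rfl⟩ := hg m
  rw [← hN]
  refine lt_of_le_of_ne (LinearMap.ker_le_ker_comp _ _) fun h => ?_
  have : m' ∈ LinearMap.ker ((Submodule.span (DualNumbers k) {g m'}).mkQ ∘ₗ g) := by
    rw [LinearMap.mem_ker, LinearMap.comp_apply, Submodule.mkQ_apply, Submodule.Quotient.mk_eq_zero]
    exact Submodule.mem_span_singleton_self _
  rw [← h] at this
  exact hm this

variable (k) in
lemma exists_distTriang : ∃ (f : boundedSingle (FGModuleCat.of (DualNumbers k) (Residue k)) ⟶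
      boundedSingle (FGModuleCat.of (DualNumbers k) (DualNumbers k)))
    (g : boundedSingle (FGModuleCat.of (DualNumbers k) (DualNumbers k)) ⟶
      boundedSingle (FGModuleCat.of (DualNumbers k) (Residue k)))
    (δ : boundedSingle (FGModuleCat.of (DualNumbers k) (Residue k)) ⟶
      (boundedSingle (FGModuleCat.of (DualNumbers k) (Residue k)))⟦(1 : ℤ)⟧),
    Triangle.mk f g δ ∈ distTriang (BoundedDerivedDual.{w} k) ∧
      ∀ v : boundedSingle (FGModuleCat.of (DualNumbers k) (DualNumbers k)) ⟶
        boundedSingle (FGModuleCat.of (DualNumbers k) (Residue k)), f ≫ v = 0 := by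
  have hx : x k • x k = 0 := x_mul_x
  obtain ⟨δ, hδ⟩ := exists_boundedSingle_distTriang (shortExact x_ne_zero hx)
  refine ⟨_, _, δ, hδ, fun v => ?_⟩
  obtain ⟨v, rfl⟩ := exists_boundedSingle_map_eq v
  exact boundedSingle_comp_eq_zero (fromResidue_comp_eq_zero v)

variable (k) in
/-- The simple module as a generator of the bounded derived category. -/
noncomputable def polynomialGenerator : PolynomialGenerator k
    (boundedSingle (FGModuleCat.of (DualNumbers k) (Residue k)) : BoundedDerivedDual.{w} k) :=
  have h := (exists_distTriang.{w} k).choose_spec.choose_spec.choose_spec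
  .ofDistTriang h.1 h.2
    (fun hn u => boundedSingle_eq_zero_of_projective hn u)
    (fun hn u => boundedSingle_eq_zero_of_neg hn u)
    (fun u => by
      obtain ⟨u, rfl⟩ := exists_boundedSingle_map_eq u
      obtain ⟨c, rfl⟩ := exists_eq_smul_id u
      exact ⟨c, boundedSingle_smul_id _ c⟩)
    (fun h => id_residue_ne_zero (id_boundedSingle_eq_zero_iff.1 h))
    (fun P h0 hP hT => bounded_induction P (boundedSingle_induction P h0 hP hT) hP hT)

end Derived

end DualNumbers

theorem proposition5p4 (k : Type u) [Field k]
    [HasDerivedCategory.{w} (FGModuleCat.{u} (DualNumbers k))] :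
    (∃ Φ : GradedCenter k (BoundedDerivedDual.{w} k) ≃ₐ[k] TrivExt k,
      ∀ n : ℤ, (GradedCenter.homogeneous k (BoundedDerivedDual.{w} k) n).map Φ.toLinearMap =
        TrivExt.homogeneous k (if ringChar k = 2 then 1 else 2) n) ∧
    Nonempty (GradedCenter.degreeZero k (BoundedDerivedDual.{w} k) ≃ₐ[k] TrivSqZeroExt k (ℕ → k)) := by
  exact ⟨(DualNumbers.polynomialGenerator k).exists_algEquiv_of_ringChar,
    (DualNumbers.polynomialGenerator k).nonempty_degreeZero_algEquiv⟩
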